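/- Permutations are ordered by containment: $\sigma\le\pi$ if $\pi$ has a subsequence order isomorphic to $\sigma$. For a set $X$ of permutations let $\operatorname{Sub}(X)=\{\pi:\pi\le\tau\text{ for some }\tau\in X\}$. Let $\operatorname{Av}(X)$ be the set of permutations containing no member of $X$. A set $B$ is the basis of a class (downward closed set) $\mathcal C$ of permutations if $B$ is an antichain under containment and $\mathcal C=\operatorname{Av}(B)$. The sum $\pi\oplus\sigma$ is $\pi$ followed by a copy of $\sigma$ placed above and to the right of it. The sum closure of $\mathcal C$ is $\bigoplus\mathcal C=\{\pi_1\oplus\cdots\oplus\pi_k:\pi_i\in\mathcal C\text{ for all }i\}$. A nonempty permutation is sum indecomposable if it is not the sum of two nonempty permutations. For each odd $n\ge 5$, consider the primary type increasing oscillation $2\,4\,1\,6\,3\,8\,5\cdots(n-4)\,n\,(n-2)$ of length $n$. A leaf of a permutation is an entry that forms an inversion with exactly one other entry. Let $\mu_{n+2}$ be the permutation of length $n+2$ obtained from this oscillation by inflating each of its two leaves (the entries $2$ and $n$) by a copy of $12$, i.e. by replacing each leaf by two entries that are adjacent and increasing in position and consecutive in value; for example $\mu_{11}=2\,3\,5\,1\,7\,4\,9\,6\,10\,11\,8$.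 Let $U^o=\{\mu_7,\mu_9,\mu_{11},\dots\}$. **Proposition.** The basis of $\bigoplus\operatorname{Sub}(U^o)$ is $\{321,\,3412,\,4123,\,23451,\,314625\}$. Moreover, if $s_n$ denotes the number of sum indecomposable permutations of length $n$ in $\bigoplus\operatorname{Sub}(U^o)$, then $(s_1,s_2,s_3,s_4,s_5)=(1,1,2,3,4)$, $s_n=4$ for every even $n\ge 6$, and $s_n=5$ for every odd $n\ge 7$; that is, $(s_n)_{n\ge1}=1,1,2,3,4,4,5,4,5,4,\dots$. -/

import Mathlib

namespace PermPattern

/-- A finite permutation, of any length: a permutation `perm` of `Fin len`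
(so positions and values are counted from `0`). The empty permutation is included. -/
structure FinPerm where
  len : ℕ
  perm : Equiv.Perm (Fin len)

/-- The permutation with one-line notation `w 0, w 1, …, w (n - 1)`, a word listing each of the
values `1, …, n` exactly once. -/
noncomputable def oneLine {n : ℕ} (w : Fin n → ℕ) (hinj : Function.Injective w)
    (hw : ∀ i, 1 ≤ w i ∧ w i ≤ n) : FinPerm where
  len := n
  perm := Equiv.ofBijective (fun i => (⟨w i - 1, by have := hw i; omega⟩ : Fin n))
    (Finite.injective_iff_bijective.1 (by
      intro i j hij
      have h : w i - 1 = w j - 1 := congrArg Fin.val hij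
      have := hw i
      have := hw j
      exact hinj (by omega)))

/-- Containment `σ ≤ π`: some subsequence of `π` is order isomorphic to `σ`. -/
def Contained (σ π : FinPerm) : Prop :=
  ∃ f : Fin σ.len ↪o Fin π.len,
    ∀ i j, σ.perm i < σ.perm j ↔ π.perm (f i) < π.perm (f j)

/-- `Av(B)`, the permutations containing no member of `B`. -/
def Av (B : Set FinPerm) : Set FinPerm :=
  {π | ∀ β ∈ B, ¬ Contained β π}

/-- `B` is the basis of the class `C`: an antichain with `C = Av(B)`. -/
def IsBasis (B C : Set FinPerm) : Prop :=
  IsAntichain Contained B ∧ C = Av B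

/-- The downward closure `Sub(X)`. -/
def Sub (X : Set FinPerm) : Set FinPerm :=
  {π | ∃ τ ∈ X, Contained π τ}

/-- The sum `π ⊕ σ`: `π` on the first positions and values, followed by `σ` shifted above it. -/
def FinPerm.sum (π σ : FinPerm) : FinPerm where
  len := π.len + σ.len
  perm := finSumFinEquiv.symm.trans ((Equiv.sumCongr π.perm σ.perm).trans finSumFinEquiv)

/-- The empty permutation. -/
def FinPerm.empty : FinPerm := ⟨0, 1⟩

/-- The sum closure `⨁ C`: all sums `π₁ ⊕ ⋯ ⊕ πₖ` of members of `C`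
(the sum of no permutations being the empty permutation). -/
def sumClosure (C : Set FinPerm) : Set FinPerm :=
  {π | ∃ l : List FinPerm, (∀ τ ∈ l, τ ∈ C) ∧ π = l.foldr FinPerm.sum FinPerm.empty}

/-- A nonempty permutation that is not the sum of two nonempty permutations. -/
def SumIndecomposable (π : FinPerm) : Prop :=
  0 < π.len ∧ ¬ ∃ σ τ : FinPerm, 0 < σ.len ∧ 0 < τ.len ∧ π = σ.sum τ

/-- The number of sum indecomposable permutations of length `n` in `C`. -/
noncomputable def sumIndecCount (C : Set FinPerm) (n : ℕ) : ℕ :=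
  {π : Equiv.Perm (Fin n) | (⟨n, π⟩ : FinPerm) ∈ C ∧ SumIndecomposable ⟨n, π⟩}.ncard

/-- The inversion graph of `π`, with each entry of `π` represented by its position. -/
def inversionGraph (π : FinPerm) : SimpleGraph (Fin π.len) :=
  SimpleGraph.fromRel (fun i j => i < j ∧ π.perm j < π.perm i)

/-- The entry of `π` in position `i` is a leaf of the inversion graph: it has exactly one
neighbour. -/
def IsLeaf (π : FinPerm) (i : Fin π.len) : Prop :=
  ∃! j, (inversionGraph π).Adj i j

/-- `π` is the inflation of `σ` in which the entry in position `i` of `σ` is replaced by an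
interval (a block of consecutive positions and consecutive values) order isomorphic to `α i`.
The positions of `π` are indexed, from left to right, by the pairs (entry of `σ`, position within
its block) in lexicographic order. -/
def IsInflation (π σ : FinPerm) (α : Fin σ.len → FinPerm) : Prop :=
  ∃ e : (Σₗ i : Fin σ.len, Fin (α i).len) ≃o Fin π.len,
    (∀ i j, ∀ (a : Fin (α i).len) (b : Fin (α j).len), σ.perm i < σ.perm j →
      π.perm (e (toLex ⟨i, a⟩)) < π.perm (e (toLex ⟨j, b⟩))) ∧
    (∀ i, ∀ a b : Fin (α i).len, (α i).perm a < (α i).perm b →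
      π.perm (e (toLex ⟨i, a⟩)) < π.perm (e (toLex ⟨i, b⟩)))

/-- The word `2 4 1 6 3 8 5 ⋯ (n-4) n (n-2)` for odd `n = 2k + 5` (`i` counts from `0`). -/
def primaryOscWord (k : ℕ) (i : Fin (2 * k + 5)) : ℕ :=
  if (i : ℕ) = 0 then 2
  else if (i : ℕ) = 2 * k + 3 then 2 * k + 5
  else if (i : ℕ) % 2 = 1 then i + 3
  else i - 1

theorem primaryOscWord_injective (k : ℕ) : Function.Injective (primaryOscWord k) := by
  intro i j h
  unfold primaryOscWord at h
  apply Fin.ext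
  split_ifs at h <;> omega

theorem primaryOscWord_range (k : ℕ) (i : Fin (2 * k + 5)) :
    1 ≤ primaryOscWord k i ∧ primaryOscWord k i ≤ 2 * k + 5 := by
  unfold primaryOscWord
  split_ifs <;> omega

/-- The increasing oscillation of primary type of odd length `2k + 5 ≥ 5`. -/
noncomputable def primaryOsc (k : ℕ) : FinPerm :=
  oneLine (primaryOscWord k) (primaryOscWord_injective k) (primaryOscWord_range k)

open Classical in
/-- The antichain `Uᵒ`: the increasing oscillations of primary type of odd length at least `5`,
with each leaf inflated by `12` (and every other entry inflated by `1`, i.e. left alone). -/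
noncomputable def antichainUo : Set FinPerm :=
  {π | ∃ k : ℕ, IsInflation π (primaryOsc k)
    (fun i => if IsLeaf (primaryOsc k) i then ⟨2, 1⟩ else ⟨1, 1⟩)}

/-- The permutations `321`, `3412`, `4123`, `23451`, `314625`. -/
noncomputable def basisUo : Set FinPerm :=
  {oneLine ![3, 2, 1] (by decide) (by decide),
   oneLine ![3, 4, 1, 2] (by decide) (by decide),
   oneLine ![4, 1, 2, 3] (by decide) (by decide),
   oneLine ![2, 3, 4, 5, 1] (by decide) (by decide),
   oneLine ![3, 1, 4, 6, 2, 5] (by decide) (by decide)}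

end PermPattern

namespace PermPattern

open Equiv

/-! The engine is an encoding of the sum indecomposable permutations of length `n + 2` avoiding 321
and 3412 by words of length `n` over a two-letter alphabet. Such a permutation, if longer than 21,
either has its maximum in the last position but one or ends in its second largest value
(`exists_eq_child`). Deleting that entry keeps it indecomposable, so by induction it grows from 21
by two kinds of insertion, `child true` and `child false`. The word records the insertions, the most
recent one first, and determines the permutation (`wordPerm_injective`); every word gives an
indecomposable permutation.

Factors of a word give contained permutations (`contained_wordPerm_of_infix`). The remaining basis
elements 4123, 23451 and 314625 are the permutations of the words FF, TTT and FTTF, so avoiding them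
forces the word to avoid these three factors. Such a word alternates, except that TT may occur at
either end; hence it is a factor of some TTF(TF)ᵏTT, which is the word of the inflated oscillation
of length `2k + 7`. So every indecomposable member of `Av basisUo` lies in `Sub antichainUo`, and
decomposing into sum components gives one inclusion.

For the other inclusion, the short list of inversions of an inflated oscillation shows that it
avoids the five patterns, and since these are indecomposable, avoidance passes to sums. The
enumeration is then a count of the words avoiding the three factors. -/

theorem FinPerm.ext_of_val {σ τ : FinPerm} (hlen : σ.len = τ.len)
    (h : ∀ i : Fin σ.len, (σ.perm i : ℕ) = τ.perm (Fin.cast hlen i)) : σ = τ := by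
  obtain ⟨n, p⟩ := σ
  obtain ⟨m, q⟩ := τ
  dsimp only at hlen
  subst hlen
  congr 1
  ext i
  exact h i

theorem FinPerm.perm_eq_of_mk_eq {n : ℕ} {π ρ : Equiv.Perm (Fin n)}
    (h : (⟨n, π⟩ : FinPerm) = ⟨n, ρ⟩) : π = ρ := by
  cases h
  rfl

theorem oneLine_perm_val {n : ℕ} (w : Fin n → ℕ) (hinj : Function.Injective w)
    (hw : ∀ i, 1 ≤ w i ∧ w i ≤ n) (i : Fin n) :
    ((oneLine w hinj hw).perm i : ℕ) = w i - 1 := rfl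

theorem oneLine_perm_lt_iff {n : ℕ} (w : Fin n → ℕ) (hinj : Function.Injective w)
    (hw : ∀ i, 1 ≤ w i ∧ w i ≤ n) (i j : Fin n) :
    (oneLine w hinj hw).perm i < (oneLine w hinj hw).perm j ↔ w i < w j := by
  rw [Fin.lt_def, oneLine_perm_val, oneLine_perm_val]
  have := hw i
  have := hw j
  omega

/-! ### Containment -/

/-- Values are linearly ordered, so preserving strict inequalities already reflects them. -/
theorem contained_of_strictMono {σ π : FinPerm} (f : Fin σ.len → Fin π.len) (hf : StrictMono f)
    (h : ∀ i j, σ.perm i < σ.perm j → π.perm (f i) < π.perm (f j)) : Contained σ π := by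
  refine ⟨OrderEmbedding.ofStrictMono f hf, fun i j => ⟨h i j, fun hlt => ?_⟩⟩
  by_contra hc
  rcases eq_or_lt_of_le (not_lt.1 hc) with e | e
  · rw [σ.perm.injective e] at hlt
    exact lt_irrefl _ hlt
  · exact lt_asymm hlt (h _ _ e)

theorem Contained.refl (π : FinPerm) : Contained π π :=
  contained_of_strictMono id strictMono_id fun _ _ h => h

theorem Contained.trans {ρ σ π : FinPerm} (h₁ : Contained ρ σ) (h₂ : Contained σ π) :
    Contained ρ π := by
  obtain ⟨f, hf⟩ := h₁
  obtain ⟨g, hg⟩ := h₂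
  exact ⟨f.trans g, fun i j => (hf i j).trans (hg _ _)⟩

theorem Contained.len_le {σ π : FinPerm} (h : Contained σ π) : σ.len ≤ π.len := by
  obtain ⟨f, -⟩ := h
  simpa using Fintype.card_le_of_injective f f.injective

theorem Av_of_contained {B : Set FinPerm} {σ π : FinPerm} (h : Contained σ π) (hπ : π ∈ Av B) :
    σ ∈ Av B := fun β hβ hc => hπ β hβ (hc.trans h)

/-! ### Sums -/

theorem FinPerm.sum_perm_castAdd (σ τ : FinPerm) (i : Fin σ.len) :
    (σ.sum τ).perm (Fin.castAdd τ.len i) = Fin.castAdd τ.len (σ.perm i) := by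
  change finSumFinEquiv (Equiv.sumCongr σ.perm τ.perm
    (finSumFinEquiv.symm (Fin.castAdd τ.len i))) = _
  rw [finSumFinEquiv_symm_apply_castAdd]
  rfl

theorem FinPerm.sum_perm_natAdd (σ τ : FinPerm) (i : Fin τ.len) :
    (σ.sum τ).perm (Fin.natAdd σ.len i) = Fin.natAdd σ.len (τ.perm i) := by
  change finSumFinEquiv (Equiv.sumCongr σ.perm τ.perm
    (finSumFinEquiv.symm (Fin.natAdd σ.len i))) = _
  rw [finSumFinEquiv_symm_apply_natAdd]
  rfl

theorem FinPerm.sum_perm_val_of_lt (σ τ : FinPerm) (i : Fin (σ.sum τ).len) (h : (i : ℕ) < σ.len) :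
    ((σ.sum τ).perm i : ℕ) = σ.perm ⟨i, h⟩ :=
  congrArg Fin.val (FinPerm.sum_perm_castAdd σ τ ⟨i, h⟩)

theorem FinPerm.sum_perm_val_of_eq_add (σ τ : FinPerm) (i : Fin (σ.sum τ).len) (j : Fin τ.len)
    (h : (i : ℕ) = σ.len + j) : ((σ.sum τ).perm i : ℕ) = σ.len + τ.perm j := by
  have : i = Fin.natAdd σ.len j := Fin.ext h
  rw [this]
  exact congrArg Fin.val (FinPerm.sum_perm_natAdd σ τ j)

theorem FinPerm.empty_sum (τ : FinPerm) : FinPerm.empty.sum τ = τ := by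
  refine FinPerm.ext_of_val (Nat.zero_add _) fun i => ?_
  rw [FinPerm.sum_perm_val_of_eq_add _ _ i (Fin.cast (Nat.zero_add _) i) (Nat.zero_add _).symm]
  exact Nat.zero_add _

theorem FinPerm.sum_empty (τ : FinPerm) : τ.sum FinPerm.empty = τ :=
  FinPerm.ext_of_val rfl fun i => FinPerm.sum_perm_val_of_lt _ _ i i.2

theorem FinPerm.sum_assoc (ρ σ τ : FinPerm) : (ρ.sum σ).sum τ = ρ.sum (σ.sum τ) := by
  refine FinPerm.ext_of_val (Nat.add_assoc _ _ _) fun i => ?_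
  have hi : (i : ℕ) < ρ.len + σ.len + τ.len := i.2
  by_cases h₁ : (i : ℕ) < ρ.len
  · rw [FinPerm.sum_perm_val_of_lt _ _ i (Nat.lt_add_right _ h₁),
      FinPerm.sum_perm_val_of_lt _ _ _ h₁, FinPerm.sum_perm_val_of_lt _ _ _ h₁]
    rfl
  by_cases h₂ : (i : ℕ) < ρ.len + σ.len
  · have h₃ : (i : ℕ) - ρ.len < σ.len := by omega
    rw [FinPerm.sum_perm_val_of_lt _ _ i h₂,
      FinPerm.sum_perm_val_of_eq_add ρ σ _ ⟨i - ρ.len, h₃⟩ (by dsimp only; omega),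
      FinPerm.sum_perm_val_of_eq_add ρ (σ.sum τ) _ ⟨i - ρ.len, Nat.lt_add_right _ h₃⟩
        (Nat.add_sub_of_le (not_lt.1 h₁)).symm,
      FinPerm.sum_perm_val_of_lt _ _ _ h₃]
  · have h₃ : (i : ℕ) - (ρ.len + σ.len) < τ.len := by omega
    have h₄ : (i : ℕ) - ρ.len < σ.len + τ.len := by omega
    rw [FinPerm.sum_perm_val_of_eq_add (ρ.sum σ) τ i ⟨i - (ρ.len + σ.len), h₃⟩
        (by dsimp only [FinPerm.sum]; omega),
      FinPerm.sum_perm_val_of_eq_add ρ (σ.sum τ) _ ⟨i - ρ.len, h₄⟩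
        (Nat.add_sub_of_le (not_lt.1 h₁)).symm,
      FinPerm.sum_perm_val_of_eq_add σ τ _ ⟨i - (ρ.len + σ.len), h₃⟩ (by dsimp only; omega)]
    exact Nat.add_assoc _ _ _

theorem FinPerm.contained_sum_left (σ τ : FinPerm) : Contained σ (σ.sum τ) := by
  refine contained_of_strictMono (Fin.castAdd τ.len) (fun i j h => h) fun i j h => ?_
  rw [FinPerm.sum_perm_castAdd, FinPerm.sum_perm_castAdd]
  exact h

theorem FinPerm.contained_sum_right (σ τ : FinPerm) : Contained τ (σ.sum τ) := by
  refine contained_of_strictMono (Fin.natAdd σ.len) (fun i j h => Nat.add_lt_add_left h _)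
    fun i j h => ?_
  rw [FinPerm.sum_perm_natAdd, FinPerm.sum_perm_natAdd]
  exact Nat.add_lt_add_left h _

theorem sumClosure_sum {C : Set FinPerm} {σ τ : FinPerm} (hσ : σ ∈ sumClosure C)
    (hτ : τ ∈ sumClosure C) : σ.sum τ ∈ sumClosure C := by
  obtain ⟨l, hl, rfl⟩ := hσ
  obtain ⟨m, hm, rfl⟩ := hτ
  refine ⟨l ++ m, fun ρ hρ => (List.mem_append.1 hρ).elim (hl ρ) (hm ρ), ?_⟩
  clear hl
  induction l with
  | nil => exact FinPerm.empty_sum _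
  | cons a l ih =>
    rw [List.cons_append, List.foldr_cons, List.foldr_cons, FinPerm.sum_assoc, ih]

theorem subset_sumClosure (C : Set FinPerm) : C ⊆ sumClosure C := fun π hπ =>
  ⟨[π], by simpa using hπ, (FinPerm.sum_empty π).symm⟩

theorem empty_mem_sumClosure (C : Set FinPerm) : FinPerm.empty ∈ sumClosure C :=
  ⟨[], by simp, rfl⟩

/-! ### Indecomposable patterns and cuts. -/

/-- No prefix of positions carries values all below those of the complementary suffix. -/
def NoSplit (β : FinPerm) : Prop :=
  ∀ c : Fin β.len, 0 < (c : ℕ) → ∃ i j, i < c ∧ c ≤ j ∧ β.perm j < β.perm i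

/-- An occurrence meeting both summands would split `β` where it crosses from `σ` to `τ`, since no
inversion of a sum joins the two summands. -/
theorem NoSplit.contained_or_contained {β σ τ : FinPerm} (hβ : NoSplit β)
    (h : Contained β (σ.sum τ)) : Contained β σ ∨ Contained β τ := by
  obtain ⟨f, hf⟩ := h
  by_cases h₁ : ∀ i, (f i : ℕ) < σ.len
  · left
    refine contained_of_strictMono (fun i => ⟨f i, h₁ i⟩) (fun i j hij => f.strictMono hij)
      fun i j hij => ?_
    have := (hf i j).1 hij
    rw [Fin.lt_def, FinPerm.sum_perm_val_of_lt _ _ _ (h₁ i),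
      FinPerm.sum_perm_val_of_lt _ _ _ (h₁ j)] at this
    exact this
  have hval : ∀ i, ¬ (f i : ℕ) < σ.len → ∃ j : Fin τ.len, (f i : ℕ) = σ.len + j := fun i hi => by
    have := (f i).2
    change (f i : ℕ) < σ.len + τ.len at this
    exact ⟨⟨f i - σ.len, by omega⟩, by dsimp only; omega⟩
  by_cases h₂ : ∀ i, ¬ (f i : ℕ) < σ.len
  · right
    choose g hg using fun i => hval i (h₂ i)
    refine contained_of_strictMono g (fun i j hij => ?_) fun i j hij => ?_
    · have : (f i : ℕ) < f j := f.strictMono hij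
      rw [hg, hg] at this
      exact Nat.lt_of_add_lt_add_left this
    · have := (hf i j).1 hij
      rw [Fin.lt_def, FinPerm.sum_perm_val_of_eq_add _ _ _ _ (hg i),
        FinPerm.sum_perm_val_of_eq_add _ _ _ _ (hg j)] at this
      exact Nat.lt_of_add_lt_add_left this
  exfalso
  push Not at h₁ h₂
  obtain ⟨a, ha⟩ := h₂
  -- `c` is the first entry of `β` placed in `τ`; `NoSplit` at `c` yields an inversion across the
  -- two summands.
  obtain ⟨c, hc, hmin⟩ := WellFounded.has_min (wellFounded_lt (α := Fin β.len))
    {i | σ.len ≤ (f i : ℕ)} h₁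
  have hac : a < c := by
    by_contra hac
    have : (f c : ℕ) ≤ f a := f.monotone (not_lt.1 hac)
    exact absurd hc (not_le.2 (this.trans_lt ha))
  obtain ⟨i, j, hi, hj, hij⟩ := hβ c (lt_of_le_of_lt (Nat.zero_le _) hac)
  have hi' : (f i : ℕ) < σ.len := by
    by_contra hcon
    exact hmin i (not_lt.1 hcon) hi
  have hj' : ¬ (f j : ℕ) < σ.len := not_lt.2 (le_trans hc (f.monotone hj))
  obtain ⟨k, hk⟩ := hval j hj'
  have := (hf j i).1 hij
  rw [Fin.lt_def, FinPerm.sum_perm_val_of_lt _ _ _ hi',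
    FinPerm.sum_perm_val_of_eq_add _ _ _ _ hk] at this
  have := (σ.perm ⟨f i, hi'⟩).2
  omega

theorem NoSplit.not_contained_of_mem_sumClosure {β : FinPerm} {C : Set FinPerm} (hβ : NoSplit β)
    (hlen : 0 < β.len) (hC : ∀ τ ∈ C, ¬ Contained β τ) {π : FinPerm} (hπ : π ∈ sumClosure C) :
    ¬ Contained β π := by
  obtain ⟨l, hl, rfl⟩ := hπ
  induction l with
  | nil => exact fun h => absurd h.len_le (not_le.2 hlen)
  | cons a l ih =>
    intro h
    rcases hβ.contained_or_contained h with h | h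
    · exact hC a (hl a (by simp)) h
    · exact ih (fun τ hτ => hl τ (by simp [hτ])) h

/-- `c` cuts `π` if the first `c` entries are exactly the `c` smallest values. -/
def IsCut {n : ℕ} (π : Equiv.Perm (Fin n)) (c : ℕ) : Prop :=
  0 < c ∧ c < n ∧ ∀ i : Fin n, (i : ℕ) < c → (π i : ℕ) < c

/-- Pigeonhole: the first `c` positions already use up all `c` smallest values. -/
theorem IsCut.le_of_le {n c : ℕ} {π : Equiv.Perm (Fin n)} (h : IsCut π c) {i : Fin n}
    (hi : c ≤ (i : ℕ)) : c ≤ (π i : ℕ) := by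
  obtain ⟨-, hc, h⟩ := h
  by_contra hlt
  have hinj : Function.Injective fun i : Fin c =>
      (⟨π ⟨i, i.2.trans hc⟩, h _ i.2⟩ : Fin c) := fun a b hab => by
    have := π.injective (Fin.ext (Fin.mk.inj hab))
    exact Fin.ext (Fin.mk.inj this)
  obtain ⟨j, hj⟩ := (Finite.injective_iff_surjective.1 hinj) ⟨π i, not_le.1 hlt⟩
  have := π.injective (Fin.ext (Fin.mk.inj hj))
  rw [← this] at hi
  exact absurd j.2 (not_lt.2 hi)

theorem sumIndecomposable_iff {n : ℕ} (π : Equiv.Perm (Fin n)) :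
    SumIndecomposable ⟨n, π⟩ ↔ 0 < n ∧ ∀ c, ¬ IsCut π c := by
  refine and_congr Iff.rfl ⟨fun h c hcut => h ?_, ?_⟩
  · obtain ⟨h0, hc, hlt⟩ := id hcut
    refine ⟨⟨c, Equiv.ofBijective (fun i : Fin c =>
        (⟨π ⟨i, i.2.trans hc⟩, hlt _ i.2⟩ : Fin c)) (Finite.injective_iff_bijective.1 ?_)⟩,
      ⟨n - c, Equiv.ofBijective (fun i : Fin (n - c) =>
        (⟨π ⟨c + i, by omega⟩ - c, by omega⟩ : Fin (n - c)))
        (Finite.injective_iff_bijective.1 ?_)⟩, h0, Nat.sub_pos_of_lt hc, ?_⟩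
    · intro a b hab
      have := π.injective (Fin.ext (Fin.mk.inj hab))
      exact Fin.ext (Fin.mk.inj this)
    · intro a b hab
      have h₁ := hcut.le_of_le (i := ⟨c + a, by omega⟩) (Nat.le_add_right _ _)
      have h₂ := hcut.le_of_le (i := ⟨c + b, by omega⟩) (Nat.le_add_right _ _)
      have h₃ := Fin.mk.inj hab
      have := Fin.mk.inj (π.injective (Fin.ext (a := π ⟨c + a, by omega⟩)
        (b := π ⟨c + b, by omega⟩) (by omega)))
      exact Fin.ext (by omega)
    · refine FinPerm.ext_of_val (Nat.add_sub_of_le hc.le).symm fun i => ?_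
      have hi : (i : ℕ) < n := i.2
      by_cases hic : (i : ℕ) < c
      · rw [FinPerm.sum_perm_val_of_lt _ _ _ hic]
        rfl
      · rw [FinPerm.sum_perm_val_of_eq_add _ _ _ (⟨i - c, by omega⟩ : Fin (n - c))
          (Nat.add_sub_of_le (not_lt.1 hic)).symm]
        have h₁ := hcut.le_of_le (not_lt.1 hic)
        have h₂ : (⟨c + (i - c), by omega⟩ : Fin n) = i := Fin.ext (by dsimp only; omega)
        simp only [Equiv.ofBijective_apply, h₂]
        omega
  · rintro h ⟨σ, τ, hσ, hτ, he⟩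
    have hn : n = σ.len + τ.len := congrArg FinPerm.len he
    subst hn
    have hp : π = (σ.sum τ).perm := FinPerm.perm_eq_of_mk_eq he
    refine h σ.len ⟨hσ, Nat.lt_add_of_pos_right hτ, fun i hi => ?_⟩
    have hv : (π i : ℕ) = σ.perm ⟨i, hi⟩ := by
      rw [hp]
      exact FinPerm.sum_perm_val_of_lt σ τ i hi
    rw [hv]
    exact (σ.perm _).2

/-! ### Inserting a point into a permutation -/

/-- The permutation obtained from `π` by inserting a new entry in position `p` with value `v`. -/
def insertPoint {n : ℕ} (p v : Fin (n + 1)) (π : Perm (Fin n)) : Perm (Fin (n + 1)) :=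
  (finSuccEquiv' p).trans ((optionCongr π).trans (finSuccEquiv' v).symm)

@[simp]
theorem insertPoint_apply_same {n : ℕ} (p v : Fin (n + 1)) (π : Perm (Fin n)) :
    insertPoint p v π p = v := by
  simp [insertPoint]

@[simp]
theorem insertPoint_apply_succAbove {n : ℕ} (p v : Fin (n + 1)) (π : Perm (Fin n)) (i : Fin n) :
    insertPoint p v π (p.succAbove i) = v.succAbove (π i) := by
  simp [insertPoint]

theorem exists_eq_insertPoint {n : ℕ} (p v : Fin (n + 1)) (τ : Perm (Fin (n + 1)))
    (h : τ p = v) : ∃ π, τ = insertPoint p v π := by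
  have hne : ∀ i, ∃ j, v.succAbove j = τ (p.succAbove i) := fun i =>
    Fin.exists_succAbove_eq fun hc => Fin.succAbove_ne p i (τ.injective (hc.trans h.symm))
  choose f hf using hne
  have hinj : Function.Injective f := fun i j hij => by
    have := hf i
    rw [hij, hf j] at this
    exact (Fin.succAbove_right_injective (τ.injective this)).symm
  refine ⟨Equiv.ofBijective f (Finite.injective_iff_bijective.1 hinj), ?_⟩
  ext x
  refine Fin.succAboveCases p ?_ (fun i => ?_) x
  · rw [insertPoint_apply_same, h]
  · rw [insertPoint_apply_succAbove, Equiv.ofBijective_apply, hf]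

theorem insertPoint_injective {n : ℕ} (p v : Fin (n + 1)) :
    Function.Injective (insertPoint p v) := fun π ρ h => by
  ext i
  have := congrArg (fun τ : Perm (Fin (n + 1)) => τ (p.succAbove i)) h
  simp only [insertPoint_apply_succAbove] at this
  exact congrArg Fin.val (Fin.succAbove_right_injective this)

theorem contained_insertPoint {n : ℕ} (p v : Fin (n + 1)) (π : Perm (Fin n)) :
    Contained ⟨n, π⟩ ⟨n + 1, insertPoint p v π⟩ := by
  refine contained_of_strictMono (σ := ⟨n, π⟩) (π := ⟨n + 1, insertPoint p v π⟩) p.succAbove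
    (Fin.strictMono_succAbove p) fun i j h => ?_
  change insertPoint p v π (p.succAbove i) < insertPoint p v π (p.succAbove j)
  rw [insertPoint_apply_succAbove, insertPoint_apply_succAbove]
  exact Fin.strictMono_succAbove v h

/-- The last index but one. -/
abbrev penult (n : ℕ) : Fin (n + 2) := (Fin.last n).castSucc

theorem penult_succAbove_last (n : ℕ) : (penult n).succAbove (Fin.last n) = Fin.last (n + 1) := by
  simp [penult]

theorem penult_succAbove_of_ne {n : ℕ} {i : Fin (n + 1)} (h : i ≠ Fin.last n) :
    (penult n).succAbove i = i.castSucc :=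
  Fin.succAbove_castSucc_of_lt _ _ (Fin.lt_last_iff_ne_last.2 h)

theorem penult_succAbove_val {n : ℕ} (i : Fin (n + 1)) :
    ((penult n).succAbove i : ℕ) = if (i : ℕ) = n then n + 1 else i := by
  split_ifs with h
  · rw [show i = Fin.last n from Fin.ext h, penult_succAbove_last, Fin.val_last]
  · rw [penult_succAbove_of_ne fun hc => h (by rw [hc, Fin.val_last]), Fin.val_castSucc]

/-- The two ways of extending a permutation: insert a new maximum just before the last entry, or
append a new entry just below the maximum. -/
def child {n : ℕ} : Bool → Perm (Fin (n + 1)) → Perm (Fin (n + 2))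
  | true, π => insertPoint (penult n) (Fin.last (n + 1)) π
  | false, π => insertPoint (Fin.last (n + 1)) (penult n) π

theorem contained_child {n : ℕ} (x : Bool) (π : Perm (Fin (n + 1))) :
    Contained ⟨n + 1, π⟩ ⟨n + 2, child x π⟩ := by
  cases x
  · exact contained_insertPoint _ _ π
  · exact contained_insertPoint _ _ π

/-- The only new candidate for a cut is `n + 1`, and it fails because the maximum of a child lies
before its last position. Elsewhere the insertion changes nothing below the cut. -/
theorem isCut_child_iff {n : ℕ} (x : Bool) (π : Perm (Fin (n + 1))) (c : ℕ) :
    IsCut (child x π) c ↔ IsCut π c := by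
  cases x <;> simp only [child]
  · constructor
    · rintro ⟨h0, hc, h⟩
      have hc' : c ≠ n + 1 := by
        rintro rfl
        have := h ((Fin.last (n + 1)).succAbove (π.symm (Fin.last n)))
          (by rw [Fin.succAbove_last, Fin.val_castSucc]; exact Fin.is_lt _)
        rw [insertPoint_apply_succAbove, apply_symm_apply, penult_succAbove_last] at this
        exact lt_irrefl _ this
      refine ⟨h0, by omega, fun i hi => ?_⟩
      have := h ((Fin.last (n + 1)).succAbove i) (by simpa using hi)
      rw [insertPoint_apply_succAbove, penult_succAbove_val] at this
      split_ifs at this <;> omega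
    · rintro ⟨h0, hc, h⟩
      refine ⟨h0, by omega, fun j => ?_⟩
      refine Fin.succAboveCases (Fin.last (n + 1)) (fun hj => ?_) (fun i hi => ?_) j
      · rw [Fin.val_last] at hj
        omega
      · rw [insertPoint_apply_succAbove, penult_succAbove_val]
        have := h i (by simpa using hi)
        split_ifs <;> omega
  · constructor
    · rintro ⟨h0, hc, h⟩
      have hc' : c ≠ n + 1 := by
        rintro rfl
        have := h (penult n) (by simp)
        rw [insertPoint_apply_same] at this
        exact lt_irrefl _ this
      refine ⟨h0, by omega, fun i hi => ?_⟩
      have := h ((penult n).succAbove i) (by rw [penult_succAbove_val]; split_ifs <;> omega)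
      simpa using this
    · rintro ⟨h0, hc, h⟩
      refine ⟨h0, by omega, fun j => ?_⟩
      refine Fin.succAboveCases (penult n) (fun hj => ?_) (fun i hi => ?_) j
      · simp at hj
        omega
      · rw [insertPoint_apply_succAbove, Fin.succAbove_last, Fin.val_castSucc]
        rw [penult_succAbove_val] at hi
        exact h i (by split_ifs at hi <;> omega)

theorem child_last_ne_last {n : ℕ} (x : Bool) (π : Perm (Fin (n + 1))) :
    child x π (Fin.last (n + 1)) ≠ Fin.last (n + 1) := by
  cases x <;> simp only [child]
  · rw [insertPoint_apply_same]
    exact Fin.castSucc_ne_last _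
  · rw [← penult_succAbove_last, insertPoint_apply_succAbove, penult_succAbove_last,
      Fin.succAbove_last]
    exact Fin.castSucc_ne_last _

/-- Equality would put the maximum of `child false ρ` in the last position but one, which holds the
last entry of `ρ`. The condition on `ρ` is needed: `12` and `1` show the ambiguity that starts below
21. -/
theorem child_true_ne_child_false {n : ℕ} {π ρ : Perm (Fin (n + 1))}
    (h : ρ (Fin.last n) ≠ Fin.last n) : child true π ≠ child false ρ := fun he => by
  have := congrArg (fun τ : Perm (Fin (n + 2)) => τ (penult n)) he
  simp only [child, insertPoint_apply_same] at this
  rw [show penult n = (Fin.last (n + 1)).succAbove (Fin.last n) from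
    (Fin.succAbove_last_apply _).symm, insertPoint_apply_succAbove, Fin.succAbove_last,
    penult_succAbove_of_ne h] at this
  exact Fin.castSucc_ne_last _ this.symm

theorem child_injective {n : ℕ} (x : Bool) :
    Function.Injective (child x : Perm (Fin (n + 1)) → _) := by
  cases x
  · exact insertPoint_injective _ _
  · exact insertPoint_injective _ _

/-- `π` is contained in `τ`, with the last entry going to the last entry and the maximum to the
maximum. -/
def CornerContained {n m : ℕ} (π : Perm (Fin (n + 1))) (τ : Perm (Fin (m + 1))) : Prop :=
  ∃ f g : Fin (n + 1) → Fin (m + 1), StrictMono f ∧ StrictMono g ∧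
    f (Fin.last n) = Fin.last m ∧ g (Fin.last n) = Fin.last m ∧ ∀ i, τ (f i) = g (π i)

theorem CornerContained.contained {n m : ℕ} {π : Perm (Fin (n + 1))} {τ : Perm (Fin (m + 1))}
    (h : CornerContained π τ) : Contained ⟨n + 1, π⟩ ⟨m + 1, τ⟩ := by
  obtain ⟨f, g, hf, hg, -, -, h⟩ := h
  refine contained_of_strictMono (σ := ⟨n + 1, π⟩) (π := ⟨m + 1, τ⟩) f hf fun i j hij => ?_
  change τ (f i) < τ (f j)
  rw [h, h]
  exact hg hij

/-- Extend a map of index sets by sending the new last index to the new last index. -/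
def extendLast {n m : ℕ} (f : Fin (n + 1) → Fin (m + 1)) : Fin (n + 2) → Fin (m + 2) :=
  Fin.lastCases (Fin.last _) fun i => (f i).castSucc

@[simp]
theorem extendLast_last {n m : ℕ} (f : Fin (n + 1) → Fin (m + 1)) :
    extendLast f (Fin.last _) = Fin.last _ := by
  simp [extendLast]

@[simp]
theorem extendLast_castSucc {n m : ℕ} (f : Fin (n + 1) → Fin (m + 1)) (i : Fin (n + 1)) :
    extendLast f i.castSucc = (f i).castSucc := by
  simp [extendLast]

theorem extendLast_strictMono {n m : ℕ} {f : Fin (n + 1) → Fin (m + 1)} (hf : StrictMono f) :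
    StrictMono (extendLast f) := by
  intro i j
  refine Fin.lastCases ?_ (fun i => ?_) i <;> refine Fin.lastCases ?_ (fun j => ?_) j
  · simp
  · intro h
    exact absurd h (not_lt.2 (Fin.le_last _))
  · intro _
    simp only [extendLast_last, extendLast_castSucc]
    exact Fin.castSucc_lt_last _
  · intro h
    simp only [extendLast_castSucc]
    exact hf h

theorem extendLast_penult_succAbove {n m : ℕ} {f : Fin (n + 1) → Fin (m + 1)} (hf : StrictMono f)
    (hl : f (Fin.last n) = Fin.last m) (i : Fin (n + 1)) :
    extendLast f ((penult n).succAbove i) = (penult m).succAbove (f i) := by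
  by_cases h : i = Fin.last n
  · rw [h, penult_succAbove_last, extendLast_last, hl, penult_succAbove_last]
  · rw [penult_succAbove_of_ne h, extendLast_castSucc, penult_succAbove_of_ne]
    rw [← hl]
    exact hf.injective.ne h

/-- Both insertions are positioned relative to the last entry and the maximum only, so an embedding
fixing these two landmarks extends to the children. Plain containment would not suffice. -/
theorem CornerContained.child {n m : ℕ} {π : Perm (Fin (n + 1))} {τ : Perm (Fin (m + 1))}
    (h : CornerContained π τ) (x : Bool) : CornerContained (child x π) (child x τ) := by
  obtain ⟨f, g, hf, hg, hfl, hgl, h⟩ := h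
  refine ⟨extendLast f, extendLast g, extendLast_strictMono hf, extendLast_strictMono hg,
    extendLast_last f, extendLast_last g, fun j => ?_⟩
  cases x <;> simp only [PermPattern.child]
  · refine Fin.succAboveCases (Fin.last (n + 1)) ?_ (fun i => ?_) j
    · rw [insertPoint_apply_same, extendLast_last, insertPoint_apply_same, extendLast_castSucc, hgl]
    · rw [insertPoint_apply_succAbove, extendLast_penult_succAbove hg hgl, Fin.succAbove_last,
        extendLast_castSucc, ← Fin.succAbove_last, insertPoint_apply_succAbove, h]
  · refine Fin.succAboveCases (penult n) ?_ (fun i => ?_) j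
    · rw [insertPoint_apply_same, extendLast_last, extendLast_castSucc, hfl, insertPoint_apply_same]
    · rw [insertPoint_apply_succAbove, extendLast_penult_succAbove hf hfl, Fin.succAbove_last,
        extendLast_castSucc, insertPoint_apply_succAbove, h, Fin.succAbove_last]

/-- The maximum and the last entry of `τ` form the required copy of 21. -/
theorem cornerContained_of_last_ne {m : ℕ} {τ : Perm (Fin (m + 2))}
    (h : τ (Fin.last _) ≠ Fin.last _) : CornerContained (swap (0 : Fin 2) 1) τ := by
  have h' : τ.symm (Fin.last _) ≠ Fin.last _ := fun hc => h (by rw [← hc, apply_symm_apply, hc])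
  refine ⟨![τ.symm (Fin.last _), Fin.last _], ![τ (Fin.last _), Fin.last _], ?_, ?_, rfl, rfl, ?_⟩
  · rw [Fin.strictMono_iff_lt_succ]
    simpa using Fin.lt_last_iff_ne_last.2 h'
  · rw [Fin.strictMono_iff_lt_succ]
    simpa using Fin.lt_last_iff_ne_last.2 h
  · simp

/-! ### Permutations built from words -/

/-- The permutation built from `2 1` by applying `child` along a word, read from right to left. -/
def build : (l : List Bool) → Perm (Fin (l.length + 2))
  | [] => swap 0 1
  | x :: l => child x (build l)

/-- `build l` as a permutation of unspecified length. -/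
def wordPerm (l : List Bool) : FinPerm := ⟨l.length + 2, build l⟩

theorem build_last_ne_last : ∀ l : List Bool, build l (Fin.last _) ≠ Fin.last _
  | [] => by decide
  | x :: l => child_last_ne_last x (build l)

theorem wordPerm_injective : Function.Injective wordPerm := by
  -- The last insertion can be read off from the permutation and undone; the lengths stay
  -- independent so that this applies to words of unknown length.
  have key : ∀ {n m : ℕ} {x y : Bool} {π : Perm (Fin (n + 1))} {ρ : Perm (Fin (m + 1))},
      π (Fin.last n) ≠ Fin.last n → ρ (Fin.last m) ≠ Fin.last m →
      (⟨n + 2, child x π⟩ : FinPerm) = ⟨m + 2, child y ρ⟩ →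
      x = y ∧ (⟨n + 1, π⟩ : FinPerm) = ⟨m + 1, ρ⟩ := by
    intro n m x y π ρ hπ hρ h
    have hnm : n + 2 = m + 2 := congrArg FinPerm.len h
    obtain rfl : n = m := by omega
    have he := FinPerm.perm_eq_of_mk_eq h
    cases x <;> cases y
    · exact ⟨rfl, by rw [child_injective _ he]⟩
    · exact absurd he.symm (child_true_ne_child_false hπ)
    · exact absurd he (child_true_ne_child_false hρ)
    · exact ⟨rfl, by rw [child_injective _ he]⟩
  intro l
  induction l with
  | nil =>
    intro l' h
    cases l' with
    | nil => rfl
    | cons y l' =>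
      have := congrArg FinPerm.len h
      simp [wordPerm] at this
  | cons x l ih =>
    intro l' h
    cases l' with
    | nil =>
      have := congrArg FinPerm.len h
      simp [wordPerm] at this
    | cons y l' =>
      obtain ⟨h₁, h₂⟩ := key (build_last_ne_last l) (build_last_ne_last l') h
      rw [h₁, ih h₂]

theorem not_isCut_build : ∀ (l : List Bool) (c : ℕ), ¬ IsCut (build l) c
  | [], c => fun ⟨h0, hc, h⟩ => by
    obtain rfl : c = 1 := by
      simp at hc
      omega
    exact absurd (h 0 Nat.one_pos) (by decide)
  | x :: l, c => fun h => not_isCut_build l c ((isCut_child_iff x (build l) c).1 h)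

theorem sumIndecomposable_wordPerm (l : List Bool) : SumIndecomposable (wordPerm l) :=
  (sumIndecomposable_iff _).2 ⟨Nat.succ_pos _, not_isCut_build l⟩

/-- The letters of `r` are applied first; forgetting them replaces `build r` by the 21 in its
corner, and the later insertions carry this along. -/
theorem cornerContained_build_append (r : List Bool) :
    ∀ l : List Bool, CornerContained (build l) (build (l ++ r))
  | [] => cornerContained_of_last_ne (build_last_ne_last r)
  | x :: l => (cornerContained_build_append r l).child x

theorem contained_wordPerm_append_left (r l : List Bool) :
    Contained (wordPerm l) (wordPerm (r ++ l)) := by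
  induction r with
  | nil => exact Contained.refl _
  | cons x r ih => exact ih.trans (contained_child x (build (r ++ l)))

/-- Dropping letters on the left deletes the most recent insertions; dropping letters on the right
restarts from a corner copy of 21. -/
theorem contained_wordPerm_of_infix {l m : List Bool} (h : l <:+: m) :
    Contained (wordPerm l) (wordPerm m) := by
  obtain ⟨s, t, rfl⟩ := h
  rw [List.append_assoc]
  exact (cornerContained_build_append t l).contained.trans (contained_wordPerm_append_left s _)

/-! ### Indecomposable permutations avoiding `321` and `3412` -/

theorem oneLine_contained_iff {n m : ℕ} (w : Fin n → ℕ) (hinj : Function.Injective w)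
    (hw : ∀ i, 1 ≤ w i ∧ w i ≤ n) (π : Perm (Fin m)) :
    Contained (oneLine w hinj hw) ⟨m, π⟩ ↔
      ∃ f : Fin n → Fin m, StrictMono f ∧ ∀ i j, w i < w j → π (f i) < π (f j) := by
  constructor
  · rintro ⟨f, hf⟩
    exact ⟨f, f.strictMono, fun i j h => (hf i j).1 ((oneLine_perm_lt_iff w hinj hw i j).2 h)⟩
  · rintro ⟨f, hf, h⟩
    exact contained_of_strictMono (σ := oneLine w hinj hw) (π := ⟨m, π⟩) f hf
      fun i j hij => h i j ((oneLine_perm_lt_iff w hinj hw i j).1 hij)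

theorem contained_321 {n : ℕ} {π : Perm (Fin n)} {i j k : Fin n} (hij : i < j) (hjk : j < k)
    (h₁ : π k < π j) (h₂ : π j < π i) :
    Contained (oneLine ![3, 2, 1] (by decide) (by decide)) ⟨n, π⟩ := by
  refine (oneLine_contained_iff _ _ _ π).2 ⟨![i, j, k], Fin.strictMono_iff_lt_succ.2 fun a => ?_,
    fun a b hab => ?_⟩
  · fin_cases a
    exacts [hij, hjk]
  · fin_cases a <;> fin_cases b <;> simp at hab ⊢ <;> order

theorem contained_3412 {n : ℕ} {π : Perm (Fin n)} {i j k l : Fin n} (hij : i < j) (hjk : j < k)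
    (hkl : k < l) (h₁ : π k < π l) (h₂ : π l < π i) (h₃ : π i < π j) :
    Contained (oneLine ![3, 4, 1, 2] (by decide) (by decide)) ⟨n, π⟩ := by
  refine (oneLine_contained_iff _ _ _ π).2 ⟨![i, j, k, l],
    Fin.strictMono_iff_lt_succ.2 fun a => ?_, fun a b hab => ?_⟩
  · fin_cases a
    exacts [hij, hjk, hkl]
  · fin_cases a <;> fin_cases b <;> simp at hab ⊢ <;> order

/-- If neither kind of insertion came last, the two largest values both precede the last two
positions, and these four entries form a 3412 or contain a 321. -/
theorem exists_eq_child {n : ℕ} {τ : Perm (Fin (n + 2))} (hcut : ∀ c, ¬ IsCut τ c)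
    (h321 : ¬ Contained (oneLine ![3, 2, 1] (by decide) (by decide)) ⟨n + 2, τ⟩)
    (h3412 : ¬ Contained (oneLine ![3, 4, 1, 2] (by decide) (by decide)) ⟨n + 2, τ⟩) :
    ∃ x π, τ = child x π := by
  have hlast : τ (Fin.last _) ≠ Fin.last _ := fun h => by
    refine hcut (n + 1) ⟨Nat.succ_pos _, Nat.lt_succ_self _, fun i hi => ?_⟩
    have : τ i ≠ Fin.last _ := fun hc => by
      rw [τ.injective (hc.trans h.symm)] at hi
      exact lt_irrefl _ hi
    exact Fin.lt_last_iff_ne_last.2 this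
  by_cases hpen : τ (penult n) = Fin.last _
  · obtain ⟨π, hπ⟩ := exists_eq_insertPoint _ _ τ hpen
    exact ⟨true, π, hπ⟩
  suffices h : τ (Fin.last _) = penult n by
    obtain ⟨π, hπ⟩ := exists_eq_insertPoint _ _ τ h
    exact ⟨false, π, hπ⟩
  by_contra hne
  obtain ⟨p, hp⟩ := τ.surjective (Fin.last _)
  obtain ⟨q, hq⟩ := τ.surjective (penult n)
  have hp₁ : p ≠ Fin.last _ := fun h => hlast (h ▸ hp)
  have hp₂ : p ≠ penult n := fun h => hpen (h ▸ hp)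
  have hq₁ : q ≠ Fin.last _ := fun h => hne (h ▸ hq)
  have hpq : p ≠ q := fun h => by
    rw [h, hq] at hp
    exact Fin.castSucc_ne_last _ hp
  have hpl : penult n < Fin.last _ := Fin.castSucc_lt_last _
  have hτ₁ : (τ (Fin.last _) : ℕ) < n := by
    have h₁ := Fin.val_ne_of_ne hlast
    have h₂ := Fin.val_ne_of_ne hne
    have h₃ := (τ (Fin.last _)).2
    simp at h₁ h₂
    omega
  have hp₃ : p < penult n := by
    have h₁ := Fin.val_ne_of_ne hp₁
    have h₂ := Fin.val_ne_of_ne hp₂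
    rw [Fin.lt_def]
    simp at h₁ h₂ ⊢
    omega
  have hτ₂ : τ (penult n) < τ p := hp ▸ Fin.lt_last_iff_ne_last.2 hpen
  -- Otherwise the maximum and the last two entries form 321.
  have hτ₃ : τ (penult n) < τ (Fin.last _) := by
    by_contra h
    refine h321 (contained_321 hp₃ hpl (lt_of_le_of_ne (not_lt.1 h) ?_) hτ₂)
    exact τ.injective.ne hpl.ne'
  have hq₂ : q ≠ penult n := fun h => by
    rw [h] at hq
    rw [hq, Fin.lt_def] at hτ₃
    simp at hτ₃
    omega
  have hq₃ : q < penult n := by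
    have h₁ := Fin.val_ne_of_ne hq₁
    have h₂ := Fin.val_ne_of_ne hq₂
    rw [Fin.lt_def]
    simp at h₁ h₂ ⊢
    omega
  have hqτ : τ (Fin.last _) < τ q := by
    rw [hq, Fin.lt_def]
    simpa using hτ₁
  have hqp : τ q < τ p := by
    rw [hp, hq]
    exact hpl
  -- If the maximum precedes the second largest value, these two and the last entry but one form
  -- 321; in the other order, the four entries form 3412.
  rcases lt_or_gt_of_ne hpq with h | h
  · exact h321 (contained_321 h hq₃ (hτ₃.trans hqτ) hqp)
  · exact h3412 (contained_3412 h hp₃ hpl hτ₃ hqτ hqp)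

theorem exists_eq_wordPerm {n : ℕ} (τ : Perm (Fin (n + 2))) (hcut : ∀ c, ¬ IsCut τ c)
    (h321 : ¬ Contained (oneLine ![3, 2, 1] (by decide) (by decide)) ⟨n + 2, τ⟩)
    (h3412 : ¬ Contained (oneLine ![3, 4, 1, 2] (by decide) (by decide)) ⟨n + 2, τ⟩) :
    ∃ l, (⟨n + 2, τ⟩ : FinPerm) = wordPerm l := by
  induction n with
  | zero =>
    have : τ = swap 0 1 := by
      have h : ¬ IsCut τ 1 := hcut 1
      clear hcut h321 h3412
      unfold IsCut at h
      revert τ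
      decide
    exact ⟨[], by rw [this]; rfl⟩
  | succ n ih =>
    obtain ⟨x, π, rfl⟩ := exists_eq_child hcut h321 h3412
    have hc := contained_child x π
    obtain ⟨l, hl⟩ := ih π (fun c h => hcut c ((isCut_child_iff x π c).2 h))
      (fun h => h321 (h.trans hc)) (fun h => h3412 (h.trans hc))
    have hn : n + 2 = l.length + 2 := congrArg FinPerm.len hl
    obtain rfl : n = l.length := by omega
    exact ⟨x :: l, by rw [FinPerm.perm_eq_of_mk_eq hl]; rfl⟩

/-- Here and in the next two lemmas the pattern is the permutation of the word itself, so the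
identity is the embedding. -/
theorem contained_4123_wordPerm :
    Contained (oneLine ![4, 1, 2, 3] (by decide) (by decide)) (wordPerm [false, false]) :=
  (oneLine_contained_iff _ _ _ _).2 ⟨id, strictMono_id, by decide⟩

theorem contained_23451_wordPerm :
    Contained (oneLine ![2, 3, 4, 5, 1] (by decide) (by decide)) (wordPerm [true, true, true]) :=
  (oneLine_contained_iff _ _ _ _).2 ⟨id, strictMono_id, by decide⟩

theorem contained_314625_wordPerm :
    Contained (oneLine ![3, 1, 4, 6, 2, 5] (by decide) (by decide))
      (wordPerm [false, true, true, false]) :=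
  (oneLine_contained_iff _ _ _ _).2 ⟨id, strictMono_id, by decide⟩

/-! ### The admissible words -/

/-- Words with no factor `[false, false]`, `[true, true, true]`, `[false, true, true, false]`. -/
def Admissible (l : List Bool) : Prop :=
  ¬ [false, false] <:+: l ∧ ¬ [true, true, true] <:+: l ∧ ¬ [false, true, true, false] <:+: l

theorem Admissible.of_suffix {l m : List Bool} (h : l <:+ m) (hm : Admissible m) : Admissible l :=
  ⟨fun hc => hm.1 (hc.trans h.isInfix), fun hc => hm.2.1 (hc.trans h.isInfix),
    fun hc => hm.2.2 (hc.trans h.isInfix)⟩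

/-- The admissible words of a given length that do not start with `true`. -/
def coreWords : ℕ → Finset (List Bool)
  | 0 => {[]}
  | 1 => {[false]}
  | m + 2 => (coreWords m).image (fun l => false :: true :: l) ∪
      if m = 1 then {[false, true, true]} else ∅

/-- The admissible words of a given length. -/
def goodWords : ℕ → Finset (List Bool)
  | 0 => coreWords 0
  | 1 => coreWords 1 ∪ (coreWords 0).image (List.cons true)
  | m + 2 => coreWords (m + 2) ∪ (coreWords (m + 1)).image (List.cons true) ∪
      (coreWords m).image (fun l => true :: true :: l)

/-- After F comes T. A further T must end the word, because FTTT and FTTF contain forbidden factors;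
otherwise FT is followed by a shorter word of the same kind. -/
theorem false_cons_mem_coreWords :
    ∀ t : List Bool, Admissible (false :: t) → false :: t ∈ coreWords (t.length + 1)
  | [], _ => by decide
  | false :: t, h => absurd ⟨[], t, rfl⟩ h.1
  | [true], _ => by decide
  | true :: false :: u, h => by
    have := false_cons_mem_coreWords u (h.of_suffix ⟨[false, true], rfl⟩)
    exact Finset.mem_union_left _ (Finset.mem_image_of_mem (fun l => false :: true :: l) this)
  | [true, true], _ => by decide
  | true :: true :: true :: u, h => absurd ⟨[false], u, rfl⟩ h.2.1
  | true :: true :: false :: u, h => absurd ⟨[], u, rfl⟩ h.2.2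

/-- At most two letters T precede the first F, as TTT is forbidden. -/
theorem mem_goodWords : ∀ l : List Bool, Admissible l → l ∈ goodWords l.length
  | [], _ => by decide
  | [false], _ => by decide
  | false :: x :: t, h =>
    Finset.mem_union_left _ (Finset.mem_union_left _ (false_cons_mem_coreWords (x :: t) h))
  | [true], _ => by decide
  | true :: false :: t, h =>
    Finset.mem_union_left _ (Finset.mem_union_right _ (Finset.mem_image_of_mem (List.cons true)
      (false_cons_mem_coreWords t (h.of_suffix ⟨[true], rfl⟩))))
  | [true, true], _ => by decide
  | true :: true :: true :: t, h => absurd ⟨[], t, rfl⟩ h.2.1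
  | true :: true :: false :: t, h =>
    Finset.mem_union_right _ (Finset.mem_image_of_mem (fun l => true :: true :: l)
      (false_cons_mem_coreWords t (h.of_suffix ⟨[true, true], rfl⟩)))

theorem length_of_mem_coreWords :
    ∀ (m : ℕ) {l : List Bool}, l ∈ coreWords m → l.length = m
  | 0, l, h => by
    rw [Finset.mem_singleton.1 h]
    rfl
  | 1, l, h => by
    rw [Finset.mem_singleton.1 h]
    rfl
  | m + 2, l, h => by
    rcases Finset.mem_union.1 h with h | h
    · obtain ⟨u, hu, rfl⟩ := Finset.mem_image.1 h
      simp [length_of_mem_coreWords m hu]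
    · split_ifs at h with hm
      · rw [Finset.mem_singleton.1 h, hm]
        rfl
      · simp at h

theorem length_of_mem_goodWords :
    ∀ (m : ℕ) {l : List Bool}, l ∈ goodWords m → l.length = m
  | 0, l, h => length_of_mem_coreWords 0 h
  | 1, l, h => by
    revert l
    decide
  | m + 2, l, h => by
    simp only [goodWords, Finset.mem_union, Finset.mem_image] at h
    rcases h with (h | ⟨u, hu, rfl⟩) | ⟨u, hu, rfl⟩
    · exact length_of_mem_coreWords _ h
    · simp [length_of_mem_coreWords _ hu]
    · simp [length_of_mem_coreWords _ hu]

theorem true_cons_notMem_coreWords (m : ℕ) (l : List Bool) : true :: l ∉ coreWords m := by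
  match m with
  | 0 => simp [coreWords]
  | 1 => simp [coreWords]
  | m + 2 =>
    simp only [coreWords, Finset.mem_union, Finset.mem_image, not_or]
    refine ⟨by simp, ?_⟩
    split_ifs <;> simp

/-- The alternating word is always present; the variant ending in TT exists exactly for odd lengths
from 3 on. -/
theorem card_coreWords :
    ∀ m : ℕ, (coreWords m).card = if Odd m ∧ 3 ≤ m then 2 else 1
  | 0 => by simp [coreWords]
  | 1 => by simp [coreWords]
  | m + 2 => by
    rw [coreWords]
    by_cases hm : m = 1
    · subst hm
      decide
    · rw [if_neg hm, Finset.union_empty, Finset.card_image_of_injective _ (fun a b h => by simpa using h),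
        card_coreWords m]
      refine if_congr ?_ rfl rfl
      rw [Nat.odd_iff, Nat.odd_iff]
      omega

/-- The three sets are disjoint because the number of leading letters T distinguishes them. -/
theorem card_goodWords_add_two (m : ℕ) : (goodWords (m + 2)).card =
    (coreWords (m + 2)).card + (coreWords (m + 1)).card + (coreWords m).card := by
  rw [goodWords, Finset.card_union_of_disjoint, Finset.card_union_of_disjoint,
    Finset.card_image_of_injective _ (List.cons_injective),
    Finset.card_image_of_injective _ (fun a b h => by simpa using h)]
  · rw [Finset.disjoint_left]
    intro l hl h
    obtain ⟨u, -, rfl⟩ := Finset.mem_image.1 h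
    exact true_cons_notMem_coreWords _ _ hl
  · rw [Finset.disjoint_left]
    intro l hl h
    obtain ⟨u, -, rfl⟩ := Finset.mem_image.1 h
    rcases Finset.mem_union.1 hl with hl | hl
    · exact true_cons_notMem_coreWords _ _ hl
    · obtain ⟨t, ht, he⟩ := Finset.mem_image.1 hl
      rw [(List.cons.inj he).2] at ht
      exact true_cons_notMem_coreWords _ _ ht

/-- The word `(true false)ᵏ true true`. -/
def startWord : ℕ → List Bool
  | 0 => [true, true]
  | k + 1 => true :: false :: startWord k

/-- The word `true true false (true false)ᵏ true true`. -/
def fullWord (k : ℕ) : List Bool := true :: true :: false :: startWord k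

theorem exists_prefix_of_mem_coreWords :
    ∀ (m : ℕ) {l : List Bool}, l ∈ coreWords m → ∃ k, l <+: false :: startWord k
  | 0, l, h => ⟨0, by
    rw [Finset.mem_singleton.1 h]
    exact List.nil_prefix⟩
  | 1, l, h => ⟨0, by
    rw [Finset.mem_singleton.1 h]
    exact ⟨_, rfl⟩⟩
  | m + 2, l, h => by
    rcases Finset.mem_union.1 h with h | h
    · obtain ⟨u, hu, rfl⟩ := Finset.mem_image.1 h
      obtain ⟨k, t, ht⟩ := exists_prefix_of_mem_coreWords m hu
      exact ⟨k + 1, t, by simp [startWord, ← ht]⟩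
    · split_ifs at h with hm
      · exact ⟨0, by
          rw [Finset.mem_singleton.1 h]
          exact List.prefix_rfl⟩
      · simp at h

/-- A core word is a prefix of `false :: startWord k`; the two letters T in front of this in
`fullWord k` leave room for up to two leading ones. -/
theorem exists_infix_of_mem_goodWords {m : ℕ} {l : List Bool} (h : l ∈ goodWords m) :
    ∃ k, l <:+: fullWord k := by
  have h₀ : ∀ {m l}, l ∈ coreWords m → ∃ k, l <:+: fullWord k := fun h => by
    obtain ⟨k, t, ht⟩ := exists_prefix_of_mem_coreWords _ h
    exact ⟨k, [true, true], t, by simp [fullWord, ← ht]⟩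
  have h₁ : ∀ {m l}, l ∈ coreWords m → ∃ k, true :: l <:+: fullWord k := fun h => by
    obtain ⟨k, t, ht⟩ := exists_prefix_of_mem_coreWords _ h
    exact ⟨k, [true], t, by simp [fullWord, ← ht]⟩
  have h₂ : ∀ {m l}, l ∈ coreWords m → ∃ k, true :: true :: l <:+: fullWord k := fun h => by
    obtain ⟨k, t, ht⟩ := exists_prefix_of_mem_coreWords _ h
    exact ⟨k, [], t, by simp [fullWord, ← ht]⟩
  match m with
  | 0 => exact h₀ h
  | 1 =>
    simp only [goodWords, Finset.mem_union, Finset.mem_image] at h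
    rcases h with h | ⟨u, hu, rfl⟩
    exacts [h₀ h, h₁ hu]
  | m + 2 =>
    simp only [goodWords, Finset.mem_union, Finset.mem_image] at h
    rcases h with (h | ⟨u, hu, rfl⟩) | ⟨u, hu, rfl⟩
    exacts [h₀ h, h₁ hu, h₂ hu]

/-! ### The inflated oscillations -/

/-- The value, counted from `0`, of the inflated oscillation of length `2k + 7` in position `i`. -/
def inflatedVal (k i : ℕ) : ℕ :=
  if i ≤ 1 then i + 1
  else if i = 3 then 0
  else if i = 2 * k + 4 ∨ i = 2 * k + 5 then i + 1
  else if i = 2 * k + 6 then 2 * k + 3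
  else if i % 2 = 0 then i + 2
  else i - 2

theorem inflatedWord_injective (k : ℕ) :
    Function.Injective fun i : Fin (2 * k + 7) => inflatedVal k i + 1 := by
  intro i j h
  simp only [inflatedVal] at h
  apply Fin.ext
  split_ifs at h <;> omega

theorem inflatedWord_range (k : ℕ) (i : Fin (2 * k + 7)) :
    1 ≤ inflatedVal k i + 1 ∧ inflatedVal k i + 1 ≤ 2 * k + 7 := by
  unfold inflatedVal
  split_ifs <;> omega

/-- The increasing oscillation of primary type and length `2k + 5` with both leaves inflated. -/
noncomputable def inflatedOsc (k : ℕ) : FinPerm :=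
  oneLine (fun i : Fin (2 * k + 7) => inflatedVal k i + 1) (inflatedWord_injective k)
    (inflatedWord_range k)

/-- The inversions of the inflated oscillation, by position. -/
theorem inflatedVal_inversion {k i j : ℕ} (hij : i < j) (hj : j < 2 * k + 7)
    (h : inflatedVal k j < inflatedVal k i) :
    (j = 3 ∧ i ≤ 2) ∨
    (j % 2 = 1 ∧ 5 ≤ j ∧ j ≤ 2 * k + 3 ∧ (i + 1 = j ∨ i + 3 = j)) ∨
    (j = 2 * k + 6 ∧ (i = 2 * k + 2 ∨ i = 2 * k + 4 ∨ i = 2 * k + 5)) := by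
  unfold inflatedVal at h
  split_ifs at h <;> omega

theorem exists_of_contained_inflatedOsc {n k : ℕ} {w : Fin n → ℕ} {hinj : Function.Injective w}
    {hw : ∀ i, 1 ≤ w i ∧ w i ≤ n} (h : Contained (oneLine w hinj hw) (inflatedOsc k)) :
    ∃ f : Fin n → ℕ, StrictMono f ∧ (∀ i, f i < 2 * k + 7) ∧
      ∀ i j, w i < w j → inflatedVal k (f i) < inflatedVal k (f j) := by
  obtain ⟨f, hf, h⟩ := (oneLine_contained_iff w hinj hw (inflatedOsc k).perm).1 h
  refine ⟨fun i => f i, hf, fun i => (f i).2, fun i j hij => ?_⟩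
  have := (oneLine_perm_lt_iff _ (inflatedWord_injective k) (inflatedWord_range k) _ _).1 (h i j hij)
  exact Nat.lt_of_add_lt_add_right this

/-- Each inversion of a pattern confines its two positions to the list in `inflatedVal_inversion`; a
few inversions per pattern already conflict. For instance, no entry has three smaller entries to its
right (4123) or four larger ones to its left (23451). -/
theorem inflatedOsc_mem_Av (k : ℕ) : inflatedOsc k ∈ Av basisUo := by
  rintro β (rfl | rfl | rfl | rfl | rfl) hβ <;>
    obtain ⟨f, hf, hlt, h⟩ := exists_of_contained_inflatedOsc hβ
  · have h01 : f 0 < f 1 := hf (by decide)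
    have h12 : f 1 < f 2 := hf (by decide)
    have := inflatedVal_inversion h01 (hlt _) (h 1 0 (by decide))
    have := inflatedVal_inversion h12 (hlt _) (h 2 1 (by decide))
    omega
  · have h01 : f 0 < f 1 := hf (by decide)
    have h12 : f 1 < f 2 := hf (by decide)
    have h23 : f 2 < f 3 := hf (by decide)
    have := inflatedVal_inversion (h01.trans h12) (hlt _) (h 2 0 (by decide))
    have := inflatedVal_inversion ((h01.trans h12).trans h23) (hlt _) (h 3 0 (by decide))
    have := inflatedVal_inversion h12 (hlt _) (h 2 1 (by decide))
    have := inflatedVal_inversion (h12.trans h23) (hlt _) (h 3 1 (by decide))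
    omega
  · have h01 : f 0 < f 1 := hf (by decide)
    have h12 : f 1 < f 2 := hf (by decide)
    have h23 : f 2 < f 3 := hf (by decide)
    have := inflatedVal_inversion h01 (hlt _) (h 1 0 (by decide))
    have := inflatedVal_inversion (h01.trans h12) (hlt _) (h 2 0 (by decide))
    have := inflatedVal_inversion ((h01.trans h12).trans h23) (hlt _) (h 3 0 (by decide))
    omega
  · have h01 : f 0 < f 1 := hf (by decide)
    have h12 : f 1 < f 2 := hf (by decide)
    have h23 : f 2 < f 3 := hf (by decide)
    have h34 : f 3 < f 4 := hf (by decide)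
    have := inflatedVal_inversion h34 (hlt _) (h 4 3 (by decide))
    have := inflatedVal_inversion (h23.trans h34) (hlt _) (h 4 2 (by decide))
    have := inflatedVal_inversion (h12.trans (h23.trans h34)) (hlt _) (h 4 1 (by decide))
    have := inflatedVal_inversion (h01.trans (h12.trans (h23.trans h34))) (hlt _)
      (h 4 0 (by decide))
    omega
  -- The 2 of 314625 has three larger entries to its left, so it lies in position 3 or `2 * k + 6`.
  -- The four entries before it exclude the former, the 5 after it the latter.
  · have h01 : f 0 < f 1 := hf (by decide)
    have h12 : f 1 < f 2 := hf (by decide)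
    have h23 : f 2 < f 3 := hf (by decide)
    have h34 : f 3 < f 4 := hf (by decide)
    have h45 : f 4 < f 5 := hf (by decide)
    have := inflatedVal_inversion h34 (hlt _) (h 4 3 (by decide))
    have := inflatedVal_inversion (h23.trans h34) (hlt _) (h 4 2 (by decide))
    have := inflatedVal_inversion (h01.trans (h12.trans (h23.trans h34))) (hlt _)
      (h 4 0 (by decide))
    have := inflatedVal_inversion h01 (hlt _) (h 1 0 (by decide))
    have := inflatedVal_inversion (h34.trans h45) (hlt _) (h 5 3 (by decide))
    omega

/-! ### Locating words in the inflated oscillations. -/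

/-- An occurrence `f` of `π` in the sequence `t`, with the last entry in position `x`, all other
positions below `X`, the maximum equal to `v`, and all other values below `V`. -/
def OccursIn (t : ℕ → ℕ) {n : ℕ} (π : Perm (Fin (n + 1))) (X x V v : ℕ) : Prop :=
  ∃ f : Fin (n + 1) → ℕ, StrictMono f ∧ (∀ i j, π i < π j → t (f i) < t (f j)) ∧
    f (Fin.last n) = x ∧ (∀ i, i ≠ Fin.last n → f i < X) ∧
    (∀ i, π i = Fin.last n → t (f i) = v) ∧ ∀ i, π i ≠ Fin.last n → t (f i) < V

/-- The positions from `X` up to `x` are free for a new entry just before the last one. Afterwards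
the old maximum `v` is an ordinary value, so the value bound becomes `v + 1`. -/
theorem OccursIn.child_true {t : ℕ → ℕ} {n : ℕ} {π : Perm (Fin (n + 1))} {X x V v : ℕ}
    (h : OccursIn t π X x V v) (z : ℕ) (h₁ : X ≤ z) (h₂ : z < x) (h₃ : v < t z) :
    OccursIn t (child true π) (z + 1) x (v + 1) (t z) := by
  obtain ⟨f, hf, hlt, hx, hX, hv, hV⟩ := h
  have hval : ∀ i, t (f i) ≤ v := fun i => by
    by_cases hi : π i = Fin.last n
    · exact (hv i hi).le
    · have := hlt i (π.symm (Fin.last n))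
        (by rw [apply_symm_apply]; exact Fin.lt_last_iff_ne_last.2 hi)
      rw [hv _ (π.apply_symm_apply _)] at this
      exact this.le
  refine ⟨(penult n).insertNth (α := fun _ => ℕ) z f, fun a b => ?_, fun a b => ?_, ?_, fun a => ?_,
    fun a => ?_, fun a => ?_⟩
  · refine Fin.succAboveCases (penult n) ?_ (fun i => ?_) a <;>
      refine Fin.succAboveCases (penult n) ?_ (fun j => ?_) b <;>
      simp only [Fin.insertNth_apply_same, Fin.insertNth_apply_succAbove] <;> intro hab
    · exact absurd hab (lt_irrefl _)
    · have : j = Fin.last n := by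
        by_contra hj
        rw [penult_succAbove_of_ne hj] at hab
        exact absurd (Fin.le_last j) (not_le.2 hab)
      rw [this, hx]
      exact h₂
    · have : i ≠ Fin.last n := by
        rintro rfl
        rw [penult_succAbove_last] at hab
        exact absurd (Fin.le_last _) (not_le.2 hab)
      exact (hX i this).trans_le h₁
    · exact hf ((Fin.strictMono_succAbove _).lt_iff_lt.1 hab)
  · refine Fin.succAboveCases (penult n) ?_ (fun i => ?_) a <;>
      refine Fin.succAboveCases (penult n) ?_ (fun j => ?_) b <;>
      simp only [child, insertPoint_apply_same, insertPoint_apply_succAbove,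
        Fin.insertNth_apply_same, Fin.insertNth_apply_succAbove] <;> intro hab
    · exact absurd hab (lt_irrefl _)
    · exact absurd (Fin.le_last _) (not_le.2 hab)
    · exact (hval i).trans_lt h₃
    · exact hlt i j ((Fin.strictMono_succAbove _).lt_iff_lt.1 hab)
  · rw [← penult_succAbove_last, Fin.insertNth_apply_succAbove, hx]
  · refine Fin.succAboveCases (penult n) ?_ (fun i => ?_) a <;>
      simp only [Fin.insertNth_apply_same, Fin.insertNth_apply_succAbove] <;> intro ha
    · exact Nat.lt_succ_self z
    · have : i ≠ Fin.last n := by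
        rintro rfl
        exact ha (penult_succAbove_last n)
      exact (hX i this).trans_le (h₁.trans (Nat.le_succ z))
  · refine Fin.succAboveCases (penult n) ?_ (fun i => ?_) a <;>
      simp only [child, insertPoint_apply_same, insertPoint_apply_succAbove,
        Fin.insertNth_apply_same, Fin.insertNth_apply_succAbove] <;> intro ha
    · trivial
    · exact absurd ha (Fin.succAbove_ne _ _)
  · refine Fin.succAboveCases (penult n) ?_ (fun i => ?_) a <;>
      simp only [child, insertPoint_apply_same, insertPoint_apply_succAbove,
        Fin.insertNth_apply_same, Fin.insertNth_apply_succAbove] <;> intro ha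
    · exact absurd rfl ha
    · exact Nat.lt_succ_of_le (hval i)

/-- The mirror image with positions and values exchanged: the values from `V` up to `v` are free for
a new last entry. -/
theorem OccursIn.child_false {t : ℕ → ℕ} {n : ℕ} {π : Perm (Fin (n + 1))} {X x V v : ℕ}
    (h : OccursIn t π X x V v) (z : ℕ) (h₁ : x < z) (h₂ : V ≤ t z) (h₃ : t z < v) :
    OccursIn t (child false π) (x + 1) z (t z + 1) v := by
  obtain ⟨f, hf, hlt, hx, hX, hv, hV⟩ := h
  have hpos : ∀ i, f i ≤ x := fun i => hx ▸ hf.monotone (Fin.le_last i)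
  refine ⟨(Fin.last (n + 1)).insertNth (α := fun _ => ℕ) z f, fun a b => ?_, fun a b => ?_, ?_,
    fun a => ?_, fun a => ?_, fun a => ?_⟩
  · refine Fin.succAboveCases (Fin.last (n + 1)) ?_ (fun i => ?_) a <;>
      refine Fin.succAboveCases (Fin.last (n + 1)) ?_ (fun j => ?_) b <;>
      simp only [Fin.insertNth_apply_same, Fin.insertNth_apply_succAbove] <;> intro hab
    · exact absurd hab (lt_irrefl _)
    · exact absurd (Fin.le_last _) (not_le.2 hab)
    · exact (hpos i).trans_lt h₁
    · exact hf ((Fin.strictMono_succAbove _).lt_iff_lt.1 hab)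
  · refine Fin.succAboveCases (Fin.last (n + 1)) ?_ (fun i => ?_) a <;>
      refine Fin.succAboveCases (Fin.last (n + 1)) ?_ (fun j => ?_) b <;>
      simp only [child, insertPoint_apply_same, insertPoint_apply_succAbove,
        Fin.insertNth_apply_same, Fin.insertNth_apply_succAbove] <;> intro hab
    · exact absurd hab (lt_irrefl _)
    · have : π j = Fin.last n := by
        by_contra hj
        rw [penult_succAbove_of_ne hj] at hab
        exact absurd (Fin.le_last (π j)) (not_le.2 hab)
      rw [hv j this]
      exact h₃
    · have : π i ≠ Fin.last n := by
        intro hi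
        rw [hi, penult_succAbove_last] at hab
        exact absurd (Fin.le_last _) (not_le.2 hab)
      exact (hV i this).trans_le h₂
    · exact hlt i j ((Fin.strictMono_succAbove _).lt_iff_lt.1 hab)
  · rw [Fin.insertNth_apply_same]
  · refine Fin.succAboveCases (Fin.last (n + 1)) ?_ (fun i => ?_) a <;>
      simp only [Fin.insertNth_apply_same, Fin.insertNth_apply_succAbove] <;> intro ha
    · exact absurd rfl ha
    · exact Nat.lt_succ_of_le (hpos i)
  · refine Fin.succAboveCases (Fin.last (n + 1)) ?_ (fun i => ?_) a <;>
      simp only [child, insertPoint_apply_same, insertPoint_apply_succAbove,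
        Fin.insertNth_apply_same, Fin.insertNth_apply_succAbove] <;> intro ha
    · exact absurd ha (Fin.castSucc_ne_last _)
    · refine hv i ?_
      by_contra hi
      rw [penult_succAbove_of_ne hi] at ha
      exact Fin.castSucc_ne_last _ ha
  · refine Fin.succAboveCases (Fin.last (n + 1)) ?_ (fun i => ?_) a <;>
      simp only [child, insertPoint_apply_same, insertPoint_apply_succAbove,
        Fin.insertNth_apply_same, Fin.insertNth_apply_succAbove] <;> intro ha
    · exact Nat.lt_succ_self _
    · have : π i ≠ Fin.last n := by
        intro hi
        exact ha (by rw [hi, penult_succAbove_last])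
      exact (hV i this).trans_le (h₂.trans (Nat.le_succ _))

/-- The entries in positions 0 and 3 form 21; positions 1 and 2 supply the initial TT. Each further
TF uses position `2 * k + 5`, whose value `2 * k + 3` is the single free value, and then position `2
* k + 4` with a new maximum. -/
theorem occursIn_startWord (K : ℕ) : ∀ k ≤ K,
    OccursIn (inflatedVal K) (build (startWord k)) (2 * k + 3) (2 * k + 3) (2 * k + 3) (2 * k + 4)
  | 0, _ => by
    have h : OccursIn (inflatedVal K) (build []) 1 3 1 1 := by
      refine ⟨![0, 3], Fin.strictMono_iff_lt_succ.2 (by decide), ?_, rfl, ?_, ?_, ?_⟩ <;>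
        simp [Fin.forall_fin_two, build, inflatedVal]
    have h₁ := h.child_true 1 (by decide) (by decide) (by simp [inflatedVal])
    have h₂ := h₁.child_true 2 (by decide) (by decide) (by simp [inflatedVal])
    have e₁ : inflatedVal K 1 = 2 := rfl
    have e₂ : inflatedVal K 2 = 4 := by simp [inflatedVal]
    rw [e₁, e₂] at h₂
    exact h₂
  | k + 1, hk => by
    have h := occursIn_startWord K k (by omega)
    have e₁ : inflatedVal K (2 * k + 5) = 2 * k + 3 := by
      unfold inflatedVal
      split_ifs <;> omega
    have e₂ : inflatedVal K (2 * k + 4) = 2 * k + 6 := by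
      unfold inflatedVal
      split_ifs <;> omega
    have h₁ := h.child_false (2 * k + 5) (by omega) (by omega) (by omega)
    have h₂ := h₁.child_true (2 * k + 4) (by omega) (by omega) (by omega)
    have h₃ : OccursIn (inflatedVal K) (build (startWord (k + 1))) (2 * k + 4 + 1) (2 * k + 5)
      (2 * k + 4 + 1) (inflatedVal K (2 * k + 4)) := h₂
    rw [e₂] at h₃
    exact h₃

/-- The final F is the last entry, in position `2 * k + 6`, and the final TT is the inflated leaf in
positions `2 * k + 4` and `2 * k + 5`. Both permutations have length `2 * k + 7`. -/
theorem contained_fullWord_inflatedOsc (k : ℕ) : Contained (wordPerm (fullWord k)) (inflatedOsc k) := by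
  have e₁ : inflatedVal k (2 * k + 6) = 2 * k + 3 := by
    unfold inflatedVal
    split_ifs <;> omega
  have e₂ : inflatedVal k (2 * k + 4) = 2 * k + 5 := by
    unfold inflatedVal
    split_ifs <;> omega
  have e₃ : inflatedVal k (2 * k + 5) = 2 * k + 6 := by
    unfold inflatedVal
    split_ifs <;> omega
  have h₁ := (occursIn_startWord k k le_rfl).child_false (2 * k + 6) (by omega) (by omega)
    (by omega)
  have h₂ := h₁.child_true (2 * k + 4) (by omega) (by omega) (by omega)
  obtain ⟨f, hf, hlt, hx, -⟩ := h₂.child_true (2 * k + 5) (by omega) (by omega) (by omega)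
  have hb : ∀ i, f i < 2 * k + 7 := fun i =>
    lt_of_le_of_lt (hf.monotone (Fin.le_last i)) (lt_of_eq_of_lt hx (Nat.lt_succ_self _))
  refine contained_of_strictMono (σ := wordPerm (fullWord k)) (π := inflatedOsc k)
    (fun i => ⟨f i, hb i⟩) (fun i j hij => hf hij) fun i j hij => ?_
  exact (oneLine_perm_lt_iff _ (inflatedWord_injective k) (inflatedWord_range k) ⟨f i, hb i⟩
    ⟨f j, hb j⟩).2 (Nat.add_lt_add_right (hlt i j hij) 1)

/-! ### The inflated oscillations as inflations -/

/-- An inflation is determined by its data. This reduces an arbitrary member of `antichainUo` to the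
explicit `inflatedOsc k`. -/
theorem IsInflation.contained {π π' σ : FinPerm} {α : Fin σ.len → FinPerm}
    (h : IsInflation π σ α) (h' : IsInflation π' σ α) : Contained π π' := by
  obtain ⟨e, h₁, h₂⟩ := h
  obtain ⟨e', h₁', h₂'⟩ := h'
  refine contained_of_strictMono (fun p => e' (e.symm p)) (e'.strictMono.comp e.symm.strictMono) ?_
  intro p q hpq
  obtain ⟨x, rfl⟩ := e.surjective p
  obtain ⟨y, rfl⟩ := e.surjective q
  rw [OrderIso.symm_apply_apply, OrderIso.symm_apply_apply]
  obtain ⟨⟨i, a⟩, rfl⟩ := toLex.surjective x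
  obtain ⟨⟨j, b⟩, rfl⟩ := toLex.surjective y
  rcases lt_trichotomy (σ.perm i) (σ.perm j) with hij | hij | hij
  · exact h₁' i j a b hij
  · obtain rfl := σ.perm.injective hij
    rcases lt_trichotomy ((α i).perm a) ((α i).perm b) with hab | hab | hab
    · exact h₂' i a b hab
    · rw [(α i).perm.injective hab] at hpq
      exact absurd hpq (lt_irrefl _)
    · exact absurd hpq (lt_asymm (h₂ i b a hab))
  · exact absurd hpq (lt_asymm (h₁ j i b a hij))

theorem primaryOsc_adj_iff (k : ℕ) (i j : Fin (2 * k + 5)) :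
    (inversionGraph (primaryOsc k)).Adj i j ↔
      (i < j ∧ primaryOscWord k j < primaryOscWord k i) ∨
      (j < i ∧ primaryOscWord k i < primaryOscWord k j) := by
  have h : ∀ i j : Fin (2 * k + 5), (primaryOsc k).perm i < (primaryOsc k).perm j ↔
      primaryOscWord k i < primaryOscWord k j :=
    oneLine_perm_lt_iff _ (primaryOscWord_injective k) (primaryOscWord_range k)
  rw [← h, ← h]
  refine (SimpleGraph.fromRel_adj _ _ _).trans ⟨fun h => h.2, fun h => ⟨?_, h⟩⟩
  rintro rfl
  rcases h with h | h <;> exact lt_irrefl _ h.1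

theorem isLeaf_primaryOsc_iff (k : ℕ) (i : Fin (2 * k + 5)) :
    IsLeaf (primaryOsc k) i ↔ (i : ℕ) = 0 ∨ (i : ℕ) = 2 * k + 3 := by
  have hleaf : IsLeaf (primaryOsc k) i ↔ ∃! j : Fin (2 * k + 5),
      ((i : ℕ) < j ∧ primaryOscWord k j < primaryOscWord k i) ∨
      ((j : ℕ) < i ∧ primaryOscWord k i < primaryOscWord k j) :=
    existsUnique_congr (primaryOsc_adj_iff k i)
  rw [hleaf]
  have hlt := i.2
  constructor
  · intro h
    by_contra hi
    obtain ⟨c, -, hc⟩ := h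
    -- Two distinct neighbours refute uniqueness: positions 0 and 1 for `i = 2`, positions `i - 3`
    -- and `i - 1` for other even `i`, and `i + 1` and `i + 3` for odd `i`.
    have key : ∀ a b : Fin (2 * k + 5), (a : ℕ) ≠ b → a = c → b ≠ c :=
      fun a b hne ha hb => hne (congrArg Fin.val (ha.trans hb.symm))
    rcases Nat.even_or_odd' (i : ℕ) with ⟨d, hd | hd⟩
    · by_cases h2 : (i : ℕ) = 2
      · refine key ⟨0, by omega⟩ ⟨1, by omega⟩ (by simp) (hc _ ?_) (hc _ ?_) <;>
          unfold primaryOscWord <;> dsimp only <;> right <;> split_ifs <;> omega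
      · refine key ⟨i - 3, by omega⟩ ⟨i - 1, by omega⟩ (by dsimp only; omega) (hc _ ?_) (hc _ ?_) <;>
          unfold primaryOscWord <;> dsimp only <;> right <;> split_ifs <;> omega
    · refine key ⟨i + 1, by omega⟩ ⟨i + 3, by omega⟩ (by simp) (hc _ ?_) (hc _ ?_) <;>
        unfold primaryOscWord <;> dsimp only <;> left <;> split_ifs <;> omega
  · rintro (h | h)
    · refine ⟨⟨2, by omega⟩, ?_, fun j hj => Fin.ext ?_⟩
      · left
        unfold primaryOscWord
        dsimp only
        rw [if_pos h, if_neg (by omega), if_neg (by omega), if_neg (by omega)]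
        omega
      · unfold primaryOscWord at hj
        dsimp only at hj ⊢
        split_ifs at hj <;> omega
    · refine ⟨⟨2 * k + 4, by omega⟩, ?_, fun j hj => Fin.ext ?_⟩
      · unfold primaryOscWord
        dsimp only
        left
        split_ifs <;> omega
      · have := j.2
        unfold primaryOscWord at hj
        dsimp only at hj ⊢
        split_ifs at hj <;> omega

/-- The position, after inflation of the leaves, of the `a`-th entry of the block of entry `i`. -/
def blockPos (k i a : ℕ) : ℕ :=
  i + (if 0 < i then 1 else 0) + (if 2 * k + 3 < i then 1 else 0) + a

/-- Doubling the leaf of value 2 raises all larger values by one. The other leaf is the maximum, so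
doubling it shifts no value. -/
theorem inflatedVal_blockPos {k a : ℕ} {i : Fin (2 * k + 5)}
    (ha : a < if (i : ℕ) = 0 ∨ (i : ℕ) = 2 * k + 3 then 2 else 1) :
    inflatedVal k (blockPos k i a) =
      primaryOscWord k i - 1 + (if 2 < primaryOscWord k i then 1 else 0) + a := by
  have hi := i.2
  obtain ⟨p, hp⟩ : ∃ p, p = blockPos k i a := ⟨_, rfl⟩
  obtain ⟨w, hw⟩ : ∃ w, w = primaryOscWord k i := ⟨_, rfl⟩
  rw [← hp, ← hw]
  unfold blockPos at hp
  unfold primaryOscWord at hw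
  have h : (i : ℕ) = 0 ∨ (i : ℕ) = 2 * k + 3 ∨ (i : ℕ) = 2 * k + 4 ∨
      (1 ≤ (i : ℕ) ∧ (i : ℕ) ≤ 2 * k + 2) := by omega
  rcases h with h | h | h | h
  · have ha : a < 2 := by split_ifs at ha <;> omega
    have hp : p = a := by split_ifs at hp <;> omega
    have hw : w = 2 := by split_ifs at hw; omega
    subst hp hw
    unfold inflatedVal
    split_ifs <;> omega
  · have ha : a < 2 := by split_ifs at ha <;> omega
    have hp : p = 2 * k + 4 + a := by split_ifs at hp <;> omega
    have hw : w = 2 * k + 5 := by split_ifs at hw <;> omega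
    subst hp hw
    unfold inflatedVal
    split_ifs <;> omega
  · have ha : a = 0 := by split_ifs at ha <;> omega
    have hp : p = 2 * k + 6 := by split_ifs at hp <;> omega
    have hw : w = 2 * k + 3 := by split_ifs at hw <;> omega
    subst ha hp hw
    unfold inflatedVal
    split_ifs <;> omega
  · have ha : a = 0 := by split_ifs at ha <;> omega
    have hp : p = i + 1 := by split_ifs at hp <;> omega
    have hw : (i : ℕ) % 2 = 1 ∧ w = i + 3 ∨ (i : ℕ) % 2 = 0 ∧ w = i - 1 := by
      split_ifs at hw <;> omega
    subst ha hp
    unfold inflatedVal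
    split_ifs <;> omega

open Classical in
/-- The permutations replacing the entries of the oscillation. -/
noncomputable abbrev leafBlock (k : ℕ) (i : Fin (primaryOsc k).len) : FinPerm :=
  if IsLeaf (primaryOsc k) i then ⟨2, 1⟩ else ⟨1, 1⟩

theorem leafBlock_len (k : ℕ) (i : Fin (2 * k + 5)) :
    (leafBlock k i).len = if (i : ℕ) = 0 ∨ (i : ℕ) = 2 * k + 3 then 2 else 1 := by
  unfold leafBlock
  by_cases h : IsLeaf (primaryOsc k) i
  · rw [if_pos h, if_pos ((isLeaf_primaryOsc_iff k i).1 h)]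
  · rw [if_neg h, if_neg fun hc => h ((isLeaf_primaryOsc_iff k i).2 hc)]

theorem leafBlock_perm (k : ℕ) (i : Fin (2 * k + 5)) (a : Fin (leafBlock k i).len) :
    (leafBlock k i).perm a = a := by
  have : ∀ β : FinPerm, β = ⟨2, 1⟩ ∨ β = ⟨1, 1⟩ → ∀ a, β.perm a = a := by
    rintro β (rfl | rfl) a <;> rfl
  refine this _ ?_ a
  unfold leafBlock
  split_ifs <;> simp

theorem isInflation_inflatedOsc (k : ℕ) :
    IsInflation (inflatedOsc k) (primaryOsc k) (leafBlock k) := by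
  have hlen : ∀ (i : Fin (2 * k + 5)) (a : Fin (leafBlock k i).len),
      (a : ℕ) < if (i : ℕ) = 0 ∨ (i : ℕ) = 2 * k + 3 then 2 else 1 := fun i a =>
    lt_of_lt_of_eq a.2 (leafBlock_len k i)
  have hb : ∀ (i : Fin (2 * k + 5)) (a : Fin (leafBlock k i).len),
      blockPos k i a < 2 * k + 7 := fun i a => by
    have := hlen i a
    have := i.2
    unfold blockPos
    split_ifs at * <;> omega
  let e : (Σₗ i : Fin (2 * k + 5), Fin (leafBlock k i).len) → Fin (2 * k + 7) :=
    fun x => ⟨blockPos k (ofLex x).1 (ofLex x).2, hb _ _⟩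
  have he : StrictMono e := by
    intro x y hxy
    obtain ⟨⟨i, a⟩, rfl⟩ := toLex.surjective x
    obtain ⟨⟨j, b⟩, rfl⟩ := toLex.surjective y
    change blockPos k i a < blockPos k j b
    have ha := hlen i a
    have := i.2
    have := j.2
    rcases hxy with ⟨_, _, h⟩ | ⟨_, _, hab⟩
    · have h : (i : ℕ) < j := h
      unfold blockPos
      split_ifs at * <;> omega
    · exact Nat.add_lt_add_left hab _
  have hsurj : Function.Surjective e := by
    have key : ∀ (p : Fin (2 * k + 7)) (i a : ℕ) (hi : i < 2 * k + 5),
        (a < if i = 0 ∨ i = 2 * k + 3 then 2 else 1) → blockPos k i a = p → ∃ x, e x = p :=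
      fun p i a hi ha hp => ⟨toLex ⟨⟨i, hi⟩, ⟨a, lt_of_lt_of_eq ha (leafBlock_len k ⟨i, hi⟩).symm⟩⟩,
        Fin.ext hp⟩
    intro p
    have hp := p.2
    by_cases h₁ : (p : ℕ) ≤ 1
    · refine key p 0 p (by omega) (by simp; omega) (by simp [blockPos])
    by_cases h₂ : (p : ℕ) ≤ 2 * k + 4
    · refine key p (p - 1) 0 (by omega) (by split_ifs <;> omega) ?_
      unfold blockPos
      split_ifs <;> omega
    by_cases h₃ : (p : ℕ) = 2 * k + 5
    · refine key p (2 * k + 3) 1 (by omega) (by simp) ?_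
      unfold blockPos
      split_ifs <;> omega
    · refine key p (2 * k + 4) 0 (by omega) (by simp) ?_
      unfold blockPos
      split_ifs <;> omega
  have hlt : ∀ x y, inflatedVal k (e x) < inflatedVal k (e y) →
      (inflatedOsc k).perm (e x) < (inflatedOsc k).perm (e y) := fun x y h =>
    (oneLine_perm_lt_iff _ (inflatedWord_injective k) (inflatedWord_range k) (e x) (e y)).2
      (Nat.add_lt_add_right h 1)
  refine ⟨StrictMono.orderIsoOfSurjective e he hsurj, fun i j a b hij => ?_, fun i a b hab => ?_⟩
  · refine hlt _ _ ?_
    have hij := (oneLine_perm_lt_iff _ (primaryOscWord_injective k) (primaryOscWord_range k) i j).1 hij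
    change inflatedVal k (blockPos k i a) < inflatedVal k (blockPos k j b)
    rw [inflatedVal_blockPos (hlen i a), inflatedVal_blockPos (hlen j b)]
    have h₁ := hlen i a
    have h₂ := primaryOscWord_range k i
    have h₃ := primaryOscWord_range k j
    -- Only a leaf has a second entry, one unit higher. It stays below larger blocks, since these
    -- are shifted if the leaf is 2 and do not exist if it is the maximum.
    have h₄ : (i : ℕ) = 0 ∨ (i : ℕ) = 2 * k + 3 →
        primaryOscWord k i = 2 ∨ primaryOscWord k i = 2 * k + 5 := by
      unfold primaryOscWord
      rintro (h | h) <;> simp [h]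
    split_ifs at h₁ <;> split_ifs <;> omega
  · refine hlt _ _ ?_
    have hab : a < b :=
      lt_of_eq_of_lt (leafBlock_perm k i a).symm (lt_of_lt_of_eq hab (leafBlock_perm k i b))
    change inflatedVal k (blockPos k i a) < inflatedVal k (blockPos k i b)
    rw [inflatedVal_blockPos (hlen i a), inflatedVal_blockPos (hlen i b)]
    exact Nat.add_lt_add_left hab _

theorem inflatedOsc_mem_antichainUo (k : ℕ) : inflatedOsc k ∈ antichainUo :=
  ⟨k, isInflation_inflatedOsc k⟩

theorem antichainUo_subset_Av : antichainUo ⊆ Av basisUo := by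
  rintro π ⟨k, hk⟩
  exact Av_of_contained (hk.contained (isInflation_inflatedOsc k)) (inflatedOsc_mem_Av k)

/-! ### The class and its basis -/

theorem admissible_of_mem_Av {l : List Bool} (h : wordPerm l ∈ Av basisUo) : Admissible l :=
  ⟨fun hc => h _ (by simp [basisUo])
      (contained_4123_wordPerm.trans (contained_wordPerm_of_infix hc)),
    fun hc => h _ (by simp [basisUo])
      (contained_23451_wordPerm.trans (contained_wordPerm_of_infix hc)),
    fun hc => h _ (by simp [basisUo])
      (contained_314625_wordPerm.trans (contained_wordPerm_of_infix hc))⟩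

theorem wordPerm_mem_Sub {m : ℕ} {l : List Bool} (h : l ∈ goodWords m) :
    wordPerm l ∈ Sub antichainUo := by
  obtain ⟨k, hk⟩ := exists_infix_of_mem_goodWords h
  exact ⟨inflatedOsc k, inflatedOsc_mem_antichainUo k,
    (contained_wordPerm_of_infix hk).trans (contained_fullWord_inflatedOsc k)⟩

theorem noSplit_oneLine {n : ℕ} {w : Fin n → ℕ} {hinj : Function.Injective w}
    {hw : ∀ i, 1 ≤ w i ∧ w i ≤ n}
    (h : ∀ c : Fin n, 0 < (c : ℕ) → ∃ i j, i < c ∧ c ≤ j ∧ w j < w i) :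
    NoSplit (oneLine w hinj hw) := by
  intro c hc
  obtain ⟨i, j, hi, hj, hij⟩ := h c hc
  exact ⟨i, j, hi, hj, (oneLine_perm_lt_iff w hinj hw j i).2 hij⟩

theorem noSplit_of_mem_basisUo {β : FinPerm} (h : β ∈ basisUo) : NoSplit β := by
  rcases h with rfl | rfl | rfl | rfl | rfl <;> exact noSplit_oneLine (by decide)

theorem three_le_len_of_mem_basisUo {β : FinPerm} (h : β ∈ basisUo) : 3 ≤ β.len := by
  rcases h with rfl | rfl | rfl | rfl | rfl <;> simp [oneLine]

theorem mem_Av_of_len_lt {π : FinPerm} (h : π.len < 3) : π ∈ Av basisUo := fun _ hβ hc =>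
  absurd hc.len_le (not_le.2 (h.trans_le (three_le_len_of_mem_basisUo hβ)))

theorem sumClosure_subset_Av : sumClosure (Sub antichainUo) ⊆ Av basisUo := fun _ hπ β hβ =>
  (noSplit_of_mem_basisUo hβ).not_contained_of_mem_sumClosure
    (Nat.lt_of_lt_of_le (by decide) (three_le_len_of_mem_basisUo hβ))
    (fun _ hτ hc => hτ.elim fun _ hu => antichainUo_subset_Av hu.1 β hβ (hc.trans hu.2)) hπ

theorem exists_goodWord {n : ℕ} {τ : Perm (Fin (n + 2))} (h : (⟨n + 2, τ⟩ : FinPerm) ∈ Av basisUo)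
    (hi : SumIndecomposable ⟨n + 2, τ⟩) : ∃ l ∈ goodWords n, (⟨n + 2, τ⟩ : FinPerm) = wordPerm l := by
  obtain ⟨l, hl⟩ := exists_eq_wordPerm τ ((sumIndecomposable_iff τ).1 hi).2
    (h _ (by simp [basisUo])) (h _ (by simp [basisUo]))
  have hn : n + 2 = l.length + 2 := congrArg FinPerm.len hl
  obtain rfl : n = l.length := by omega
  exact ⟨l, mem_goodWords l (admissible_of_mem_Av (hl ▸ h)), hl⟩

theorem mem_Sub_of_len_eq_one {π : FinPerm} (h : π.len = 1) : π ∈ Sub antichainUo := by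
  have : Subsingleton (Fin π.len) := by
    rw [h]
    infer_instance
  refine ⟨inflatedOsc 0, inflatedOsc_mem_antichainUo 0,
    contained_of_strictMono (fun _ => (0 : Fin 7)) (fun i j hij => ?_) fun i j hij => ?_⟩
  · exact absurd hij (Subsingleton.elim i j ▸ lt_irrefl _)
  · exact absurd hij (Subsingleton.elim i j ▸ lt_irrefl _)

/-- Avoidance passes to summands, so induction on length reduces to indecomposable permutations.
Length 1 is separate because the words encode only lengths from 2 on. -/
theorem mem_sumClosure_of_mem_Av (π : FinPerm) (h : π ∈ Av basisUo) :
    π ∈ sumClosure (Sub antichainUo) := by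
  obtain ⟨n, hn⟩ : ∃ n, π.len = n := ⟨_, rfl⟩
  induction n using Nat.strong_induction_on generalizing π with
  | _ n ih =>
    by_cases hi : SumIndecomposable π
    · obtain ⟨m, τ⟩ := π
      match m, τ, h, hi, hn with
      | 0, _, _, hi, _ => exact absurd hi.1 (lt_irrefl _)
      | 1, _, _, _, _ => exact subset_sumClosure _ (mem_Sub_of_len_eq_one rfl)
      | m + 2, τ, h, hi, _ =>
        obtain ⟨l, hl, he⟩ := exists_goodWord h hi
        rw [he]
        exact subset_sumClosure _ (wordPerm_mem_Sub hl)
    · by_cases h0 : 0 < π.len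
      · obtain ⟨σ, τ, hσ, hτ, rfl⟩ : ∃ σ τ : FinPerm, 0 < σ.len ∧ 0 < τ.len ∧ π = σ.sum τ := by
          by_contra hc
          exact hi ⟨h0, hc⟩
        have hlen : σ.len + τ.len = n := hn
        exact sumClosure_sum
          (ih σ.len (by omega) σ (Av_of_contained (FinPerm.contained_sum_left σ τ) h) rfl)
          (ih τ.len (by omega) τ (Av_of_contained (FinPerm.contained_sum_right σ τ) h) rfl)
      · have : π = FinPerm.empty := FinPerm.ext_of_val (Nat.eq_zero_of_not_pos h0)
          fun i => absurd (lt_of_le_of_lt (Nat.zero_le _) i.2) h0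
        rw [this]
        exact empty_mem_sumClosure _

theorem sumClosure_Sub_antichainUo : sumClosure (Sub antichainUo) = Av basisUo :=
  Set.Subset.antisymm sumClosure_subset_Av mem_sumClosure_of_mem_Av

/-! ### The basis is an antichain. -/

theorem exists_of_oneLine_contained_oneLine {n m : ℕ} {w : Fin n → ℕ} {hinj : Function.Injective w}
    {hw : ∀ i, 1 ≤ w i ∧ w i ≤ n} {w' : Fin m → ℕ} {hinj' : Function.Injective w'}
    {hw' : ∀ i, 1 ≤ w' i ∧ w' i ≤ m} (h : Contained (oneLine w hinj hw) (oneLine w' hinj' hw')) :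
    ∃ f : Fin n → Fin m, StrictMono f ∧ ∀ i j, w i < w j → w' (f i) < w' (f j) := by
  obtain ⟨f, hf, h⟩ := (oneLine_contained_iff w hinj hw (oneLine w' hinj' hw').perm).1 h
  exact ⟨f, hf, fun i j hij => (oneLine_perm_lt_iff w' hinj' hw' _ _).1 (h i j hij)⟩

theorem not_contained_321_oneLine {m : ℕ} {w : Fin m → ℕ} {hinj : Function.Injective w}
    {hw : ∀ i, 1 ≤ w i ∧ w i ≤ m}
    (h : ∀ a b, a < b → w b < w a → ∀ c, b < c → ¬ w c < w b) :
    ¬ Contained (oneLine ![3, 2, 1] (by decide) (by decide)) (oneLine w hinj hw) := fun hc => by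
  obtain ⟨f, hf, hlt⟩ := exists_of_oneLine_contained_oneLine hc
  exact h (f 0) (f 1) (hf (by decide)) (hlt _ _ (by decide)) (f 2) (hf (by decide))
    (hlt _ _ (by decide))

/-- The criterion ignores the order of the two small entries, so it excludes 3421 as well. -/
theorem not_contained_3412_oneLine {m : ℕ} {w : Fin m → ℕ} {hinj : Function.Injective w}
    {hw : ∀ i, 1 ≤ w i ∧ w i ≤ m}
    (h : ∀ a b, a < b → w a < w b → ∀ c, b < c → w c < w a → ∀ d, c < d → ¬ w d < w a) :
    ¬ Contained (oneLine ![3, 4, 1, 2] (by decide) (by decide)) (oneLine w hinj hw) := fun hc => by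
  obtain ⟨f, hf, hlt⟩ := exists_of_oneLine_contained_oneLine hc
  exact h (f 0) (f 1) (hf (by decide)) (hlt _ _ (by decide)) (f 2) (hf (by decide))
    (hlt _ _ (by decide)) (f 3) (hf (by decide)) (hlt _ _ (by decide))

/-- It is enough that no entry has three smaller entries to its right. -/
theorem not_contained_4123_oneLine {m : ℕ} {w : Fin m → ℕ} {hinj : Function.Injective w}
    {hw : ∀ i, 1 ≤ w i ∧ w i ≤ m}
    (h : ∀ a b, a < b → w b < w a → ∀ c, b < c → w c < w a → ∀ d, c < d → ¬ w d < w a) :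
    ¬ Contained (oneLine ![4, 1, 2, 3] (by decide) (by decide)) (oneLine w hinj hw) := fun hc => by
  obtain ⟨f, hf, hlt⟩ := exists_of_oneLine_contained_oneLine hc
  exact h (f 0) (f 1) (hf (by decide)) (hlt _ _ (by decide)) (f 2) (hf (by decide))
    (hlt _ _ (by decide)) (f 3) (hf (by decide)) (hlt _ _ (by decide))

/-- It is enough that no entry has four larger entries to its left. -/
theorem not_contained_23451_oneLine {m : ℕ} {w : Fin m → ℕ} {hinj : Function.Injective w}
    {hw : ∀ i, 1 ≤ w i ∧ w i ≤ m}
    (h : ∀ e d, d < e → w e < w d → ∀ c, c < d → w e < w c → ∀ b, b < c → w e < w b →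
      ∀ a, a < b → ¬ w e < w a) :
    ¬ Contained (oneLine ![2, 3, 4, 5, 1] (by decide) (by decide)) (oneLine w hinj hw) :=
  fun hc => by
    obtain ⟨f, hf, hlt⟩ := exists_of_oneLine_contained_oneLine hc
    exact h (f 4) (f 3) (hf (by decide)) (hlt _ _ (by decide)) (f 2) (hf (by decide))
      (hlt _ _ (by decide)) (f 1) (hf (by decide)) (hlt _ _ (by decide)) (f 0) (hf (by decide))
      (hlt _ _ (by decide))

theorem isAntichain_basisUo : IsAntichain Contained basisUo := by
  rintro β (rfl | rfl | rfl | rfl | rfl) γ (rfl | rfl | rfl | rfl | rfl) hne <;>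
  first
  | exact absurd rfl hne
  | (refine not_contained_321_oneLine ?_; decide)
  | (refine not_contained_3412_oneLine ?_; decide)
  | (refine not_contained_4123_oneLine ?_; decide)
  | (refine not_contained_23451_oneLine ?_; decide)
  | (refine fun h => absurd h.len_le ?_; simp [oneLine])

/-! ### Enumeration -/

theorem sumIndecCount_one : sumIndecCount (Av basisUo) 1 = 1 := by
  refine Set.ncard_eq_one.2 ⟨1, Set.eq_singleton_iff_unique_mem.2
    ⟨⟨mem_Av_of_len_lt (by decide), (sumIndecomposable_iff 1).2 ⟨Nat.one_pos, ?_⟩⟩,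
      fun _ _ => Subsingleton.elim _ _⟩⟩
  rintro c ⟨h0, hc, -⟩
  omega

/-- `wordPerm` is a bijection from the good words of length `m` to the permutations counted; both
sides are compared as sets in `FinPerm`. -/
theorem sumIndecCount_add_two (m : ℕ) :
    sumIndecCount (Av basisUo) (m + 2) = (goodWords m).card := by
  have hinj : Function.Injective fun π : Perm (Fin (m + 2)) => (⟨m + 2, π⟩ : FinPerm) :=
    fun _ _ h => FinPerm.perm_eq_of_mk_eq h
  unfold sumIndecCount
  rw [← Set.ncard_image_of_injective _ hinj, ← Set.ncard_coe_finset,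
    ← Set.ncard_image_of_injective _ wordPerm_injective]
  congr 1
  ext π
  constructor
  · rintro ⟨τ, ⟨h, hi⟩, rfl⟩
    obtain ⟨l, hl, he⟩ := exists_goodWord h hi
    exact ⟨l, hl, he.symm⟩
  · rintro ⟨l, hl, rfl⟩
    obtain rfl := length_of_mem_goodWords m hl
    exact ⟨build l, ⟨sumClosure_subset_Av (subset_sumClosure _ (wordPerm_mem_Sub hl)),
      sumIndecomposable_wordPerm l⟩, rfl⟩

end PermPattern

theorem mainTheorem7 :
    PermPattern.IsBasis PermPattern.basisUo
      (PermPattern.sumClosure (PermPattern.Sub PermPattern.antichainUo)) ∧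
    PermPattern.sumIndecCount
      (PermPattern.sumClosure (PermPattern.Sub PermPattern.antichainUo)) 1 = 1 ∧
    PermPattern.sumIndecCount
      (PermPattern.sumClosure (PermPattern.Sub PermPattern.antichainUo)) 2 = 1 ∧
    PermPattern.sumIndecCount
      (PermPattern.sumClosure (PermPattern.Sub PermPattern.antichainUo)) 3 = 2 ∧
    PermPattern.sumIndecCount
      (PermPattern.sumClosure (PermPattern.Sub PermPattern.antichainUo)) 4 = 3 ∧
    PermPattern.sumIndecCount
      (PermPattern.sumClosure (PermPattern.Sub PermPattern.antichainUo)) 5 = 4 ∧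
    (∀ n : ℕ, 6 ≤ n → Even n → PermPattern.sumIndecCount
      (PermPattern.sumClosure (PermPattern.Sub PermPattern.antichainUo)) n = 4) ∧
    (∀ n : ℕ, 7 ≤ n → Odd n → PermPattern.sumIndecCount
      (PermPattern.sumClosure (PermPattern.Sub PermPattern.antichainUo)) n = 5) := by
  rw [PermPattern.sumClosure_Sub_antichainUo]
  -- Length `m + 4` means words of length `m + 2`, hence core words of lengths `m + 2`, `m + 1` and
  -- `m`. The parity of `m` then gives 1 + 2 + 1 for even `m ≥ 2` and 2 + 1 + 2 for odd `m ≥ 3`.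
  have hcount : ∀ m, PermPattern.sumIndecCount (PermPattern.Av PermPattern.basisUo) (m + 4) =
      (if Odd (m + 2) ∧ 3 ≤ m + 2 then 2 else 1) + (if Odd (m + 1) ∧ 3 ≤ m + 1 then 2 else 1) +
        if Odd m ∧ 3 ≤ m then 2 else 1 := fun m => by
    rw [PermPattern.sumIndecCount_add_two, PermPattern.card_goodWords_add_two,
      PermPattern.card_coreWords, PermPattern.card_coreWords, PermPattern.card_coreWords]
  refine ⟨⟨PermPattern.isAntichain_basisUo, rfl⟩, PermPattern.sumIndecCount_one,
    (PermPattern.sumIndecCount_add_two 0).trans (by decide),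
    (PermPattern.sumIndecCount_add_two 1).trans (by decide),
    (hcount 0).trans (by decide), (hcount 1).trans (by decide), fun n hn he => ?_, fun n hn ho => ?_⟩
  · obtain ⟨m, rfl⟩ := Nat.exists_eq_add_of_le' (show 4 ≤ n by omega)
    rw [hcount]
    simp only [Nat.odd_iff, Nat.even_iff] at *
    split_ifs <;> omega
  · obtain ⟨m, rfl⟩ := Nat.exists_eq_add_of_le' (show 4 ≤ n by omega)
    rw [hcount]
    simp only [Nat.odd_iff] at *
    split_ifs <;> omega
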